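/- Let $\mathbb D=\{z\in\mathbb C:|z|<1\}$ and let $dA$ denote Lebesgue area measure. A radial weight is a function $\omega:\mathbb D\to[0,\infty)$ with $\omega(z)=\omega(|z|)$ for all $z\in\mathbb D$, $\int_0^1\omega(r)\,dr<\infty$, and $\widehat\omega(z)=\int_{|z|}^1\omega(t)\,dt>0$ for all $z\in\mathbb D$. The class $\mathcal D$ consists of the radial weights $\omega$ for which there are constants $C,C',K>1$ with $$\widehat\omega(r)\le C\,\widehat\omega\Big(\frac{1+r}2\Big)\quad\text{and}\quad \widehat\omega(r)\ge C'\,\widehat\omega\Big(1-\frac{1-r}K\Big),\qquad 0\le r<1.$$ For $x\in\mathbb R$ and a radial weight $\nu$ write $\nu_{[x]}(z)=\nu(z)(1-|z|)^x$. For $f$ analytic in $\mathbb D$, $0<p,q<\infty$ and $0<r<1$ put $$\|f\|_{D^p_\nu}^p=\int_{\mathbb D}|f'|^p\nu\,dA+|f(0)|^p,\qquad M_\infty(r,f)=\max_{|z|=r}|f(z)|,\qquad M_q(r,f)=\Big(\frac1{2\pi}\int_0^{2\pi}|f(re^{i\theta})|^q\,d\theta\Big)^{1/q},$$ $$J^p_\omega(f)=\int_0^1M_\infty^p(r,f)\,\omega(r)\,dr,\qquad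 I_{p,q,\omega}(f)=\int_0^1M_q^p(r,f')(1-r)^{p(1-\frac1q)}\omega(r)\,dr.$$ All these quantities take values in $[0,\infty]$. **Theorem.** Let $2\le p,q<\infty$ and $\omega\in\mathcal D$. Then $$\|f\|_{D^p_{\omega_{[p-1]}}}^p+|f(0)|^p\asymp\|f\|_{D^p_{\widehat\omega_{[p-2]}}}^p+|f(0)|^p\asymp J^p_\omega(f)\asymp I_{p,q,\omega}(f)+|f(0)|^p$$ for all univalent (that is, analytic and injective) functions $f$ in $\mathbb D$. Here $A\asymp B$ means that there is a finite constant $c>0$, independent of $f$, such that $A(f)\le c\,B(f)$ and $B(f)\le c\,A(f)$ for all such $f$; in particular, if one of the four quantities is finite, so are the others. -/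

import Mathlib

open MeasureTheory Set
open scoped ENNReal NNReal

namespace WeightedDirichlet

noncomputable section

/-- The open unit disc of the complex plane. -/
abbrev disc : Set ℂ := Metric.ball (0 : ℂ) 1

/-- The tail integral `∫_{|z|}^1 ν(t) dt` of a weight `ν`, as a function on the disc. -/
def tail (ν : ℂ → ℝ) (z : ℂ) : ℝ := ∫ t in ‖z‖..1, ν (t : ℂ)

/-- Radial weights: nonnegative radial functions on the disc that are integrable on the radius
`(0,1)`, with strictly positive tail integral. Only the values on the disc matter. -/
structure IsRadialWeight (ν : ℂ → ℝ) : Prop where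
  nonneg : ∀ z ∈ disc, 0 ≤ ν z
  radial : ∀ z ∈ disc, ν z = ν (‖z‖ : ℂ)
  integrable : IntegrableOn (fun r : ℝ => ν (r : ℂ)) (Ioo 0 1)
  tail_pos : ∀ z ∈ disc, 0 < tail ν z

/-- The upper doubling condition on the tail integral. -/
def UpperDoubling (ω : ℂ → ℝ) : Prop :=
  ∃ C : ℝ, 1 < C ∧ ∀ r : ℝ, 0 ≤ r → r < 1 →
    tail ω (r : ℂ) ≤ C * tail ω (((1 + r) / 2 : ℝ) : ℂ)

/-- The lower (reverse) doubling condition on the tail integral. -/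
def LowerDoubling (ω : ℂ → ℝ) : Prop :=
  ∃ K : ℝ, 1 < K ∧ ∃ C : ℝ, 1 < C ∧ ∀ r : ℝ, 0 ≤ r → r < 1 →
    C * tail ω ((1 - (1 - r) / K : ℝ) : ℂ) ≤ tail ω (r : ℂ)

/-- Two-sided doubling radial weights. -/
structure IsDoublingWeight (ω : ℂ → ℝ) : Prop where
  weight : IsRadialWeight ω
  upper : UpperDoubling ω
  lower : LowerDoubling ω

/-- The weight `ν_[x](z) = ν(z) (1 - |z|)^x`. -/
def shift (ν : ℂ → ℝ) (x : ℝ) (z : ℂ) : ℝ := ν z * (1 - ‖z‖) ^ x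

/-- The univalent functions: analytic and injective on the disc. -/
def univalent : Set (ℂ → ℂ) := {f | DifferentiableOn ℂ f disc ∧ InjOn f disc}

/-- The `p`-th power of the weighted Bergman norm, `∫_𝔻 |g|^p ν dA`; it may be infinite. -/
def bergmanPow (p : ℝ) (ν : ℂ → ℝ) (g : ℂ → ℂ) : ℝ≥0∞ :=
  ∫⁻ z in disc, ‖g z‖ₑ ^ p * ENNReal.ofReal (ν z)

/-- The `p`-th power of the weighted Dirichlet norm, `‖f'‖^p + |f(0)|^p` with the Bergman
norm of `f'`; it may be infinite. -/
def dirichletPow (p : ℝ) (ν : ℂ → ℝ) (f : ℂ → ℂ) : ℝ≥0∞ :=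
  bergmanPow p ν (deriv f) + ‖f 0‖ₑ ^ p

/-- The integral mean `M_q(r,g)`, for `0 < q < ∞`. -/
def integralMean (q r : ℝ) (g : ℂ → ℂ) : ℝ≥0∞ :=
  ((ENNReal.ofReal (2 * Real.pi))⁻¹ *
    ∫⁻ θ in Ioo 0 (2 * Real.pi), ‖g (circleMap 0 r θ)‖ₑ ^ q) ^ (1 / q)

/-- The maximum modulus `M_∞(r,f)` on the circle of radius `r`. -/
def maxModulus (r : ℝ) (f : ℂ → ℂ) : ℝ≥0∞ := ⨆ z ∈ Metric.sphere (0 : ℂ) r, ‖f z‖ₑ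

/-- `J_ω^p(f) = ∫_0^1 M_∞^p(r,f) ω(r) dr`. -/
def J (p : ℝ) (ω : ℂ → ℝ) (f : ℂ → ℂ) : ℝ≥0∞ :=
  ∫⁻ r in Ioo (0 : ℝ) 1, maxModulus r f ^ p * ENNReal.ofReal (ω (r : ℂ))

/-- `I_{p,q,ω}(f) = ∫_0^1 M_q^p(r,f') (1 - r)^{p(1 - 1/q)} ω(r) dr`. -/
def I (p q : ℝ) (ω : ℂ → ℝ) (f : ℂ → ℂ) : ℝ≥0∞ :=
  ∫⁻ r in Ioo (0 : ℝ) 1, integralMean q r (deriv f) ^ p *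
    ENNReal.ofReal ((1 - r) ^ (p * (1 - 1 / q)) * ω (r : ℂ))

/-- Comparability `A(f) ≍ B(f)` for all `f ∈ U`, for quantities with values in `[0,∞]`: each is
bounded by a finite constant, independent of `f`, times the other. -/
def ComparableOn (U : Set (ℂ → ℂ)) (A B : (ℂ → ℂ) → ℝ≥0∞) : Prop :=
  (∃ C : ℝ≥0, 0 < C ∧ ∀ f ∈ U, A f ≤ C * B f) ∧ (∃ C : ℝ≥0, 0 < C ∧ ∀ f ∈ U, B f ≤ C * A f)

end

end WeightedDirichlet

namespace WeightedDirichlet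

/-! ### Comparability -/

/-! The four quantities are compared through sums over the nodes `1 - κ ^ n`, where `κ` is the
reciprocal of the number `K` in the lower doubling condition. Two-sided doubling makes the tail of
`ω` decrease geometrically along the nodes. Hence, for increasing `G`, the integral of `G(r) (1 - r)
^ α ω(r)` is comparable to the sum over `n ≥ 1` of `G(node κ n) * tail ω (node κ n) * κ ^ (n α)`
(`isNodeWeight_shift`). The weight `tail ω (r) (1 - r) ^ (α - 1)` gives the same sums
(`isNodeWeight_tail`), because a cell has length comparable to `κ ^ n`; so the two Dirichlet weights
cannot be told apart.

Maximum moduli and circle means are increasing in `r`, so this applies to `J` and `I`. In polar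
coordinates the Dirichlet integrals become the case `q = p` of `I`, as `p (1 - 1/p) = p - 1`. It
remains to compare `J` with `I + |f(0)| ^ p` for every exponent `q ≥ 2`.

`J` is bounded by `I + |f(0)| ^ p` for every analytic `f`: the growth of the maximum modulus between
consecutive nodes is at most the gap times the maximum of `|f'|`, a discrete Hardy inequality sums
these increments, and a Poisson kernel estimate bounds the maximum of `|f'|` by its `q`-mean on a
larger circle.

The converse uses univalence. The integral of `|f'| ^ 2` over a disc is the area of its image, hence
at most `π` times the square of the maximum modulus. This controls the `2`-means of `f'`, and
Cauchy's estimate for the remaining power `q - 2` controls the `q`-means (`circleMean_deriv_le`).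

All inequalities are in `[0,∞]`, so finiteness never has to be assumed. -/

lemma ComparableOn.symm {U : Set (ℂ → ℂ)} {A B : (ℂ → ℂ) → ℝ≥0∞} (h : ComparableOn U A B) :
    ComparableOn U B A := ⟨h.2, h.1⟩

lemma exists_bound_trans {U : Set (ℂ → ℂ)} {A B D : (ℂ → ℂ) → ℝ≥0∞}
    (h₁ : ∃ C : ℝ≥0, 0 < C ∧ ∀ f ∈ U, A f ≤ C * B f)
    (h₂ : ∃ C : ℝ≥0, 0 < C ∧ ∀ f ∈ U, B f ≤ C * D f) :
    ∃ C : ℝ≥0, 0 < C ∧ ∀ f ∈ U, A f ≤ C * D f := by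
  obtain ⟨c, hc, h⟩ := h₁
  obtain ⟨d, hd, h'⟩ := h₂
  refine ⟨c * d, mul_pos hc hd, fun f hf => (h f hf).trans ?_⟩
  rw [ENNReal.coe_mul, mul_assoc]
  gcongr
  exact h' f hf

lemma ComparableOn.trans {U : Set (ℂ → ℂ)} {A B D : (ℂ → ℂ) → ℝ≥0∞} (h : ComparableOn U A B)
    (h' : ComparableOn U B D) : ComparableOn U A D :=
  ⟨exists_bound_trans h.1 h'.1, exists_bound_trans h'.2 h.2⟩

lemma exists_bound_add {U : Set (ℂ → ℂ)} {A B : (ℂ → ℂ) → ℝ≥0∞} (D : (ℂ → ℂ) → ℝ≥0∞)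
    (h : ∃ C : ℝ≥0, 0 < C ∧ ∀ f ∈ U, A f ≤ C * B f) :
    ∃ C : ℝ≥0, 0 < C ∧ ∀ f ∈ U, A f + D f ≤ C * (B f + D f) := by
  obtain ⟨c, hc, h⟩ := h
  refine ⟨c + 1, by positivity, fun f hf => ?_⟩
  calc A f + D f ≤ c * B f + 1 * D f := by rw [one_mul]; gcongr; exact h f hf
    _ ≤ (c + 1) * B f + (c + 1) * D f := by gcongr <;> simp
    _ = _ := by push_cast; ring

lemma ComparableOn.add_right {U : Set (ℂ → ℂ)} {A B : (ℂ → ℂ) → ℝ≥0∞} (h : ComparableOn U A B)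
    (D : (ℂ → ℂ) → ℝ≥0∞) : ComparableOn U (fun f => A f + D f) (fun f => B f + D f) :=
  ⟨exists_bound_add D h.1, exists_bound_add D h.2⟩

/-- Needed because `dirichletPow` already contains the term `|f(0)| ^ p` which the theorem adds once
more. -/
lemma comparableOn_add_add (U : Set (ℂ → ℂ)) (A D : (ℂ → ℂ) → ℝ≥0∞) :
    ComparableOn U (fun f => A f + D f + D f) (fun f => A f + D f) := by
  refine ⟨⟨2, by simp, fun f _ => ?_⟩, ⟨1, by simp, fun f _ => by simp⟩⟩
  calc A f + D f + D f ≤ A f + D f + (D f + A f) := by gcongr; simp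
    _ = _ := by push_cast; ring

/-! ### Tails of doubling weights -/

lemma IsRadialWeight.intervalIntegrable {ω : ℂ → ℝ} (h : IsRadialWeight ω) {a b : ℝ}
    (ha : 0 ≤ a) (hab : a ≤ b) (hb : b ≤ 1) :
    IntervalIntegrable (fun r : ℝ => ω (r : ℂ)) volume a b := by
  rw [intervalIntegrable_iff_integrableOn_Ioo_of_le hab]
  exact h.integrable.mono_set (Ioo_subset_Ioo ha hb)

lemma norm_coe_of_nonneg {r : ℝ} (hr : 0 ≤ r) : ‖(r : ℂ)‖ = r := by simp [abs_of_nonneg hr]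

lemma coe_mem_disc {r : ℝ} (hr : 0 ≤ r) (hr1 : r < 1) : (r : ℂ) ∈ disc := by
  simpa [abs_of_nonneg hr] using hr1

lemma IsRadialWeight.tail_pos_coe {ω : ℂ → ℝ} (h : IsRadialWeight ω) {r : ℝ} (hr : 0 ≤ r)
    (hr1 : r < 1) : 0 < tail ω (r : ℂ) := h.tail_pos _ (coe_mem_disc hr hr1)

lemma IsRadialWeight.tail_sub {ω : ℂ → ℝ} (h : IsRadialWeight ω) {a b : ℝ}
    (ha : 0 ≤ a) (hab : a ≤ b) (hb : b < 1) :
    tail ω (a : ℂ) - tail ω (b : ℂ) = ∫ t in a..b, ω (t : ℂ) := by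
  rw [tail, tail, norm_coe_of_nonneg ha, norm_coe_of_nonneg (ha.trans hab),
    ← intervalIntegral.integral_add_adjacent_intervals (h.intervalIntegrable ha hab hb.le)
      (h.intervalIntegrable (ha.trans hab) hb.le le_rfl)]
  ring

lemma IsRadialWeight.ae_nonneg {ω : ℂ → ℝ} (h : IsRadialWeight ω) {a b : ℝ}
    (ha : 0 ≤ a) (hb : b < 1) :
    0 ≤ᵐ[volume.restrict (Ioc a b)] (fun t : ℝ => ω (t : ℂ)) := by
  filter_upwards [ae_restrict_mem measurableSet_Ioc] with t ht
  exact h.nonneg _ (coe_mem_disc (ha.trans ht.1.le) (ht.2.trans_lt hb))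

lemma IsRadialWeight.tail_antitone {ω : ℂ → ℝ} (h : IsRadialWeight ω) {a b : ℝ}
    (ha : 0 ≤ a) (hab : a ≤ b) (hb : b < 1) : tail ω (b : ℂ) ≤ tail ω (a : ℂ) := by
  have h₁ := h.tail_sub ha hab hb
  have h₂ : 0 ≤ ∫ t in a..b, ω (t : ℂ) :=
    intervalIntegral.integral_nonneg_of_ae_restrict hab <| by
      rw [Measure.restrict_congr_set Ioc_ae_eq_Icc.symm]
      exact h.ae_nonneg ha hb
  linarith

lemma IsRadialWeight.lintegral_Ioc {ω : ℂ → ℝ} (h : IsRadialWeight ω) {a b : ℝ}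
    (ha : 0 ≤ a) (hab : a ≤ b) (hb : b < 1) :
    ∫⁻ r in Ioc a b, ENNReal.ofReal (ω (r : ℂ)) =
      ENNReal.ofReal (tail ω (a : ℂ) - tail ω (b : ℂ)) := by
  rw [h.tail_sub ha hab hb, intervalIntegral.integral_of_le hab,
    ofReal_integral_eq_lintegral_ofReal (h.intervalIntegrable ha hab hb.le).1
      (h.ae_nonneg ha hb)]

/-- Each application halves the distance to `1`. Iterating lets the upper condition bridge the ratio
`K` dictated by the lower one. -/
lemma UpperDoubling.iterate {ω : ℂ → ℝ} (h : UpperDoubling ω) :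
    ∃ C : ℝ, 1 < C ∧ ∀ (j : ℕ) (r : ℝ), 0 ≤ r → r < 1 →
      tail ω (r : ℂ) ≤ C ^ j * tail ω ((1 - (1 - r) / 2 ^ j : ℝ) : ℂ) := by
  obtain ⟨C, hC, h⟩ := h
  refine ⟨C, hC, fun j => ?_⟩
  induction j with
  | zero => intro r _ _; simp
  | succ j ih =>
    intro r h0 h1
    refine (ih r h0 h1).trans ?_
    rw [pow_succ, mul_assoc]
    have h2 : (0 : ℝ) < 2 ^ j := by positivity
    have h3 : (1 : ℝ) ≤ 2 ^ j := one_le_pow₀ (by norm_num)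
    have h4 : (1 - r) / 2 ^ j ≤ 1 - r := div_le_self (by linarith) h3
    have h5 : 0 < (1 - r) / 2 ^ j := div_pos (by linarith) h2
    have := h (1 - (1 - r) / 2 ^ j) (by linarith) (by linarith)
    have h6 : (1 + (1 - (1 - r) / 2 ^ j)) / 2 = 1 - (1 - r) / 2 ^ (j + 1) := by
      rw [pow_succ]; field_simp; ring
    rw [h6] at this
    gcongr

/-- The points `1 - κ ^ n`, which cut `[0,1)` into intervals of geometrically decreasing
length. -/
def node (κ : ℝ) (n : ℕ) : ℝ := 1 - κ ^ n

/-- Along the points `node κ n` the tail of `ω` decreases at least by the factor `c > 1` and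
at most by the factor `C`. -/
structure IsRatio (ω : ℂ → ℝ) (κ c C : ℝ) : Prop where
  pos : 0 < κ
  lt_one : κ < 1
  one_lt : 1 < c
  const_pos : 0 < C
  lower : ∀ n, c * tail ω (node κ (n + 1) : ℂ) ≤ tail ω (node κ n : ℂ)
  upper : ∀ n, tail ω (node κ n : ℂ) ≤ C * tail ω (node κ (n + 1) : ℂ)

lemma IsDoublingWeight.exists_ratio {ω : ℂ → ℝ} (h : IsDoublingWeight ω) :
    ∃ κ c C : ℝ, IsRatio ω κ c C := by
  obtain ⟨K, hK, c, hc, hl⟩ := h.lower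
  obtain ⟨C, hC, hu⟩ := h.upper.iterate
  have hK0 : 0 < K := by linarith
  -- With `K < 2 ^ j`, the point reached by `j` halvings lies beyond the next node, so monotonicity
  -- of the tail gives the upper ratio `C ^ j`.
  obtain ⟨j, hj⟩ := pow_unbounded_of_one_lt K (one_lt_two)
  suffices H : ∀ n, c * tail ω (node K⁻¹ (n + 1) : ℂ) ≤ tail ω (node K⁻¹ n : ℂ) ∧
      tail ω (node K⁻¹ n : ℂ) ≤ C ^ j * tail ω (node K⁻¹ (n + 1) : ℂ) from
    ⟨K⁻¹, c, C ^ j, by positivity, inv_lt_one_of_one_lt₀ hK, hc, by positivity,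
      fun n => (H n).1, fun n => (H n).2⟩
  intro n
  have hp : (0 : ℝ) < K⁻¹ ^ n := by positivity
  have hp1 : K⁻¹ ^ n ≤ 1 := pow_le_one₀ (by positivity) (inv_lt_one_of_one_lt₀ hK).le
  have h0 : 0 ≤ node K⁻¹ n := by unfold node; linarith
  have h1 : node K⁻¹ n < 1 := by unfold node; linarith
  have e : 1 - (1 - node K⁻¹ n) / K = node K⁻¹ (n + 1) := by
    simp only [node, pow_succ]; field_simp; ring
  have hl' := hl _ h0 h1
  rw [e] at hl'
  refine ⟨hl', (hu j _ h0 h1).trans ?_⟩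
  gcongr
  rw [← e]
  have : (1 - node K⁻¹ n) / 2 ^ j ≤ (1 - node K⁻¹ n) / K :=
    div_le_div_of_nonneg_left (by linarith) hK0 hj.le
  refine h.weight.tail_antitone ?_ (by linarith) ?_
  · rw [e]; have := pow_le_one₀ (n := n + 1) (by positivity : 0 ≤ K⁻¹) (inv_lt_one_of_one_lt₀ hK).le
    unfold node; linarith
  · have : 0 < (1 - node K⁻¹ n) / 2 ^ j := div_pos (by linarith) (by positivity)
    linarith

/-! ### Discretisation of radial integrals -/

lemma node_zero (κ : ℝ) : node κ 0 = 0 := by simp [node]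

lemma node_nonneg {κ : ℝ} (h0 : 0 < κ) (h1 : κ < 1) (n : ℕ) : 0 ≤ node κ n := by
  unfold node; linarith [pow_le_one₀ (n := n) h0.le h1.le]

lemma node_lt_one {κ : ℝ} (h0 : 0 < κ) (n : ℕ) : node κ n < 1 := by
  unfold node; linarith [pow_pos h0 n]

lemma node_mono {κ : ℝ} (h0 : 0 < κ) (h1 : κ < 1) : Monotone (node κ) := fun m n h => by
  unfold node; linarith [pow_le_pow_of_le_one h0.le h1.le h]

lemma node_succ_sub (κ : ℝ) (n : ℕ) : node κ (n + 1) - node κ n = κ ^ n * (1 - κ) := by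
  unfold node; ring

lemma node_lt_succ {κ : ℝ} (h0 : 0 < κ) (h1 : κ < 1) (n : ℕ) : node κ n < node κ (n + 1) := by
  have := node_succ_sub κ n
  have : 0 < κ ^ n * (1 - κ) := mul_pos (pow_pos h0 n) (by linarith)
  linarith

lemma iUnion_Ioc_node {κ : ℝ} (h0 : 0 < κ) (h1 : κ < 1) :
    ⋃ n, Ioc (node κ n) (node κ (n + 1)) = Ioo 0 1 := by
  ext r
  simp only [mem_iUnion, mem_Ioc, mem_Ioo]
  refine ⟨fun ⟨n, h, h'⟩ => ⟨(node_nonneg h0 h1 n).trans_lt h, h'.trans_lt (node_lt_one h0 _)⟩,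
    fun ⟨hr, hr1⟩ => ?_⟩
  obtain ⟨n, hn, hn'⟩ := exists_nat_pow_near_of_lt_one (sub_pos.2 hr1) (by linarith) h0 h1
  -- The power bracket is closed at the node `n` end, whereas the cells are closed on the right. If
  -- `r` is itself a node, it belongs to the preceding cell; the node `0` is excluded by `0 < r`.
  rcases hn'.lt_or_eq with h | h
  · exact ⟨n, by unfold node; linarith, by unfold node; linarith⟩
  · cases n with
    | zero => simp at h; linarith
    | succ n =>
      refine ⟨n, ?_, ?_⟩
      · have := node_lt_succ h0 h1 n
        unfold node at this ⊢
        linarith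
      · unfold node; linarith

lemma lintegral_Ioo_eq_tsum {κ : ℝ} (h0 : 0 < κ) (h1 : κ < 1) (F : ℝ → ℝ≥0∞) :
    ∫⁻ r in Ioo 0 1, F r = ∑' n, ∫⁻ r in Ioc (node κ n) (node κ (n + 1)), F r := by
  rw [← iUnion_Ioc_node h0 h1, lintegral_iUnion (fun _ => measurableSet_Ioc)]
  exact (node_mono h0 h1).pairwise_disjoint_on_Ioc_succ

/-- On each cell `G` is at most its value at the right end. Measurability of `ν` serves to pull this
possibly infinite constant out of the integral. -/
lemma lintegral_le_tsum_node {κ : ℝ} (h0 : 0 < κ) (h1 : κ < 1) {G ν : ℝ → ℝ≥0∞}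
    (hG : MonotoneOn G (Ico 0 1)) (hν : AEMeasurable ν (volume.restrict (Ioo 0 1)))
    {a : ℕ → ℝ≥0∞} {C : ℝ≥0∞}
    (h : ∀ n, ∫⁻ r in Ioc (node κ n) (node κ (n + 1)), ν r ≤ C * a (n + 1)) :
    ∫⁻ r in Ioo 0 1, G r * ν r ≤ C * ∑' n, G (node κ (n + 1)) * a (n + 1) := by
  rw [lintegral_Ioo_eq_tsum h0 h1, ← ENNReal.tsum_mul_left]
  refine ENNReal.tsum_le_tsum fun n => ?_
  have hsub : Ioc (node κ n) (node κ (n + 1)) ⊆ Ioo 0 1 :=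
    iUnion_Ioc_node h0 h1 ▸ subset_iUnion (fun n => Ioc (node κ n) (node κ (n + 1))) n
  calc ∫⁻ r in Ioc (node κ n) (node κ (n + 1)), G r * ν r
      ≤ ∫⁻ r in Ioc (node κ n) (node κ (n + 1)), G (node κ (n + 1)) * ν r := by
        refine setLIntegral_mono' measurableSet_Ioc fun r hr => ?_
        gcongr
        exact hG ⟨(hsub hr).1.le, (hsub hr).2⟩ ⟨node_nonneg h0 h1 _, node_lt_one h0 _⟩ hr.2
    _ = G (node κ (n + 1)) * ∫⁻ r in Ioc (node κ n) (node κ (n + 1)), ν r :=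
        lintegral_const_mul'' _ (hν.mono_measure (Measure.restrict_mono hsub le_rfl))
    _ ≤ G (node κ (n + 1)) * (C * a (n + 1)) := by gcongr; exact h n
    _ = C * (G (node κ (n + 1)) * a (n + 1)) := by ring

/-- The value of `G` at a node is at most its values on the cell to the right of that node. The cell
starting at `0` is simply discarded. -/
lemma tsum_node_le_lintegral {κ : ℝ} (h0 : 0 < κ) (h1 : κ < 1) {G ν : ℝ → ℝ≥0∞}
    (hG : MonotoneOn G (Ico 0 1)) {a : ℕ → ℝ≥0∞} {C : ℝ≥0∞}
    (h : ∀ n, a (n + 1) ≤ C * ∫⁻ r in Ioc (node κ (n + 1)) (node κ (n + 2)), ν r) :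
    ∑' n, G (node κ (n + 1)) * a (n + 1) ≤ C * ∫⁻ r in Ioo 0 1, G r * ν r := by
  have key : ∀ n, G (node κ (n + 1)) * a (n + 1) ≤
      C * ∫⁻ r in Ioc (node κ (n + 1)) (node κ (n + 2)), G r * ν r := fun n => by
    have hsub : Ioc (node κ (n + 1)) (node κ (n + 2)) ⊆ Ioo 0 1 :=
      iUnion_Ioc_node h0 h1 ▸ subset_iUnion (fun n => Ioc (node κ n) (node κ (n + 1))) (n + 1)
    calc G (node κ (n + 1)) * a (n + 1)
        ≤ G (node κ (n + 1)) * (C * ∫⁻ r in Ioc (node κ (n + 1)) (node κ (n + 2)), ν r) := by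
          gcongr; exact h n
      _ = C * (G (node κ (n + 1)) * ∫⁻ r in Ioc (node κ (n + 1)) (node κ (n + 2)), ν r) := by ring
      _ ≤ C * ∫⁻ r in Ioc (node κ (n + 1)) (node κ (n + 2)), G (node κ (n + 1)) * ν r := by
          gcongr; exact lintegral_const_mul_le _ _
      _ ≤ _ := by
          refine mul_le_mul' le_rfl (setLIntegral_mono' measurableSet_Ioc fun r hr => ?_)
          gcongr
          exact hG ⟨node_nonneg h0 h1 _, node_lt_one h0 _⟩ ⟨(hsub hr).1.le, (hsub hr).2⟩ hr.1.le
  rw [lintegral_Ioo_eq_tsum h0 h1]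
  refine (ENNReal.tsum_le_tsum key).trans ?_
  rw [ENNReal.tsum_mul_left]
  refine mul_le_mul' le_rfl ?_
  exact ENNReal.tsum_comp_le_tsum_of_injective (add_left_injective 1)
    (fun n => ∫⁻ r in Ioc (node κ n) (node κ (n + 1)), G r * ν r)

/-- The discrete weight attached to the tail of `ω` and the exponent `α`. -/
noncomputable def cell (ω : ℂ → ℝ) (κ α : ℝ) (n : ℕ) : ℝ≥0∞ :=
  ENNReal.ofReal (tail ω (node κ n : ℂ) * (κ ^ n) ^ α)

/-- The discrete counterpart of the integral of `G` against `(1 - r) ^ α ω(r)`. -/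
noncomputable def nodeSum (ω : ℂ → ℝ) (κ α : ℝ) (G : ℝ → ℝ≥0∞) : ℝ≥0∞ :=
  ∑' n, G (node κ (n + 1)) * cell ω κ α (n + 1)

/-- A radial weight whose integrals behave like those of `(1 - r) ^ α ω(r)`. -/
def IsNodeWeight (ω : ℂ → ℝ) (κ α : ℝ) (ν : ℝ → ℝ≥0∞) : Prop :=
  ∃ C : ℝ≥0, 0 < C ∧ (∀ G : ℝ → ℝ≥0∞, MonotoneOn G (Ico 0 1) →
    ∫⁻ r in Ioo 0 1, G r * ν r ≤ C * nodeSum ω κ α G ∧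
    nodeSum ω κ α G ≤ C * ∫⁻ r in Ioo 0 1, G r * ν r)

/-- Only the masses of `ν` on the cells matter. They are bounded above by the discrete weight at the
right end and below by the one at the left end, matching the end at which monotonicity freezes `G`.
-/
lemma isNodeWeight_of_cell {ω : ℂ → ℝ} {κ c C α : ℝ} (hr : IsRatio ω κ c C)
    {ν : ℝ → ℝ≥0∞} (hν : AEMeasurable ν (volume.restrict (Ioo 0 1))) {A B : ℝ}
    (hA : ∀ n, ∫⁻ r in Ioc (node κ n) (node κ (n + 1)), ν r ≤
      ENNReal.ofReal (A * (tail ω (node κ (n + 1) : ℂ) * (κ ^ (n + 1)) ^ α)))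
    (hB : ∀ n, ENNReal.ofReal (tail ω (node κ n : ℂ) * (κ ^ n) ^ α) ≤
      ENNReal.ofReal B * ∫⁻ r in Ioc (node κ n) (node κ (n + 1)), ν r)
    (hA0 : 0 ≤ A) : IsNodeWeight ω κ α ν := by
  refine ⟨A.toNNReal + B.toNNReal + 1, by positivity, fun G hG => ⟨?_, ?_⟩⟩
  · refine (lintegral_le_tsum_node hr.pos hr.lt_one hG hν (a := cell ω κ α)
      (C := ENNReal.ofReal A) fun n => ?_).trans ?_
    · rw [cell, ← ENNReal.ofReal_mul hA0]
      exact hA n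
    · rw [nodeSum]
      gcongr
      simp only [ENNReal.ofReal, ENNReal.coe_le_coe]
      rw [add_assoc]; exact le_self_add
  · refine (tsum_node_le_lintegral hr.pos hr.lt_one hG (C := ENNReal.ofReal B)
      fun n => hB (n + 1)).trans ?_
    gcongr
    simp only [ENNReal.ofReal, ENNReal.coe_le_coe]
    exact le_add_right le_add_self

lemma one_sub_mem_of_mem_node {κ : ℝ} {n : ℕ} {r : ℝ}
    (h : r ∈ Ioc (node κ n) (node κ (n + 1))) : κ ^ (n + 1) ≤ 1 - r ∧ 1 - r ≤ κ ^ n := by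
  have h₁ := h.1
  have h₂ := h.2
  unfold node at h₁ h₂
  constructor <;> linarith

lemma isNodeWeight_shift {ω : ℂ → ℝ} {κ c C α : ℝ} (hω : IsRadialWeight ω)
    (hr : IsRatio ω κ c C) (hα : 0 ≤ α) :
    IsNodeWeight ω κ α (fun r => ENNReal.ofReal (ω (r : ℂ) * (1 - r) ^ α)) := by
  have h0 := hr.pos
  have h1 := hr.lt_one
  have hc := hr.one_lt
  have hC := hr.const_pos
  have hn := node_nonneg h0 h1
  have hl := node_lt_one h0
  have hm : ∀ n, node κ n ≤ node κ (n + 1) := fun n => node_mono h0 h1 n.le_succ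
  have hκα : 0 < κ ^ α := Real.rpow_pos_of_pos h0 α
  have hpow : ∀ n, (κ ^ (n + 1)) ^ α = (κ ^ n) ^ α * κ ^ α := fun n => by
    rw [pow_succ, Real.mul_rpow (by positivity) h0.le]
  -- The `ω`-mass of a cell is a difference of tails. It is at most the left tail, which is `C`
  -- times the right one at worst, and at least `1 - c⁻¹` times the left tail, which is where lower
  -- doubling enters. The factor `κ ^ α` is the variation of `(1 - r) ^ α` over a cell.
  refine isNodeWeight_of_cell hr ?_ (A := C / κ ^ α) (B := (1 - c⁻¹)⁻¹ * (κ ^ α)⁻¹) (fun n => ?_)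
    (fun n => ?_) (by positivity)
  · have := hω.integrable.aestronglyMeasurable.aemeasurable
    exact (this.mul (by fun_prop)).ennreal_ofReal
  · calc ∫⁻ r in Ioc (node κ n) (node κ (n + 1)), ENNReal.ofReal (ω (r : ℂ) * (1 - r) ^ α)
        ≤ ∫⁻ r in Ioc (node κ n) (node κ (n + 1)),
            ENNReal.ofReal ((κ ^ n) ^ α) * ENNReal.ofReal (ω (r : ℂ)) := by
          refine setLIntegral_mono' measurableSet_Ioc fun r hr => ?_
          have hk := one_sub_mem_of_mem_node hr
          have hw : 0 ≤ ω (r : ℂ) := hω.nonneg _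
            (coe_mem_disc ((hn n).trans hr.1.le) (hr.2.trans_lt (hl _)))
          rw [← ENNReal.ofReal_mul (by positivity), mul_comm]
          have : 0 ≤ 1 - r := le_trans (by positivity) hk.1
          gcongr
          exact hk.2
      _ = ENNReal.ofReal ((κ ^ n) ^ α * (tail ω (node κ n : ℂ) - tail ω (node κ (n + 1) : ℂ))) := by
          rw [lintegral_const_mul' _ _ ENNReal.ofReal_ne_top, hω.lintegral_Ioc (hn n) (hm n) (hl _),
            ENNReal.ofReal_mul (by positivity)]
      _ ≤ _ := by
          apply ENNReal.ofReal_le_ofReal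
          have h₁ := hr.upper n
          have h₂ := hω.tail_pos_coe (hn (n + 1)) (hl (n + 1))
          calc (κ ^ n) ^ α * (tail ω (node κ n : ℂ) - tail ω (node κ (n + 1) : ℂ))
              ≤ (κ ^ n) ^ α * (C * tail ω (node κ (n + 1) : ℂ)) := by gcongr; linarith
            _ = _ := by rw [hpow]; field_simp
  · have h₁ := hr.lower n
    have h₂ := hω.tail_pos_coe (hn n) (hl n)
    have h₃ : 0 < 1 - c⁻¹ := by linarith [inv_lt_one_of_one_lt₀ hc]
    have h₄ : (1 - c⁻¹) * tail ω (node κ n : ℂ) ≤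
        tail ω (node κ n : ℂ) - tail ω (node κ (n + 1) : ℂ) := by
      have : tail ω (node κ (n + 1) : ℂ) ≤ c⁻¹ * tail ω (node κ n : ℂ) := by
        rw [le_inv_mul_iff₀ (by linarith)]; exact h₁
      linarith
    calc ENNReal.ofReal (tail ω (node κ n : ℂ) * (κ ^ n) ^ α)
        = ENNReal.ofReal ((1 - c⁻¹)⁻¹ * (κ ^ α)⁻¹) * ENNReal.ofReal
            ((κ ^ (n + 1)) ^ α * ((1 - c⁻¹) * tail ω (node κ n : ℂ))) := by
          rw [← ENNReal.ofReal_mul (by positivity), hpow]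
          congr 1
          have := h₃.ne'
          generalize 1 - c⁻¹ = d at this
          field_simp
      _ ≤ ENNReal.ofReal ((1 - c⁻¹)⁻¹ * (κ ^ α)⁻¹) * ENNReal.ofReal ((κ ^ (n + 1)) ^ α *
            (tail ω (node κ n : ℂ) - tail ω (node κ (n + 1) : ℂ))) := by gcongr
      _ = ENNReal.ofReal ((1 - c⁻¹)⁻¹ * (κ ^ α)⁻¹) * ∫⁻ r in Ioc (node κ n) (node κ (n + 1)),
            ENNReal.ofReal ((κ ^ (n + 1)) ^ α) * ENNReal.ofReal (ω (r : ℂ)) := by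
          rw [lintegral_const_mul' _ _ ENNReal.ofReal_ne_top, hω.lintegral_Ioc (hn n) (hm n) (hl _),
            ENNReal.ofReal_mul (by positivity) (p := (κ ^ (n + 1)) ^ α)]
      _ ≤ _ := by
          refine mul_le_mul' le_rfl (setLIntegral_mono' measurableSet_Ioc fun r hr => ?_)
          have hk := one_sub_mem_of_mem_node hr
          have hw : 0 ≤ ω (r : ℂ) := hω.nonneg _
            (coe_mem_disc ((hn n).trans hr.1.le) (hr.2.trans_lt (hl _)))
          rw [← ENNReal.ofReal_mul (by positivity), mul_comm]
          gcongr
          exact hk.1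

/-- On a cell the integrand is essentially constant by upper doubling alone, and the length `κ ^ n *
(1 - κ)` of the cell raises the exponent from `α` to `α + 1`. -/
lemma isNodeWeight_tail {ω : ℂ → ℝ} {κ c C α : ℝ} (hω : IsRadialWeight ω)
    (hr : IsRatio ω κ c C) (hα : 0 ≤ α) :
    IsNodeWeight ω κ (α + 1) (fun r => ENNReal.ofReal (tail ω (r : ℂ) * (1 - r) ^ α)) := by
  have h0 := hr.pos
  have h1 := hr.lt_one
  have hc := hr.one_lt
  have hC := hr.const_pos
  have hn := node_nonneg h0 h1
  have hl := node_lt_one h0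
  have hm : ∀ n, node κ n ≤ node κ (n + 1) := fun n => node_mono h0 h1 n.le_succ
  have hκα : 0 < κ ^ α := Real.rpow_pos_of_pos h0 α
  have hpow : ∀ n, (κ ^ (n + 1)) ^ α = (κ ^ n) ^ α * κ ^ α := fun n => by
    rw [pow_succ, Real.mul_rpow (by positivity) h0.le]
  have hpow' : ∀ n, (κ ^ n) ^ (α + 1) = (κ ^ n) ^ α * κ ^ n := fun n =>
    Real.rpow_add_one (by positivity) _
  have hcell : ∀ (n : ℕ) (M : ℝ), ∫⁻ _ in Ioc (node κ n) (node κ (n + 1)), ENNReal.ofReal M =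
      ENNReal.ofReal M * ENNReal.ofReal (κ ^ n * (1 - κ)) := fun n M => by
    rw [setLIntegral_const, Real.volume_Ioc, node_succ_sub]
  have h1' : 0 < 1 - κ := by linarith
  refine isNodeWeight_of_cell hr ?_ (A := C * (1 - κ) / (κ ^ α * κ))
    (B := C * (κ ^ α)⁻¹ * (1 - κ)⁻¹) (fun n => ?_)
    (fun n => ?_) (by positivity)
  · have : AEMeasurable (fun r : ℝ => tail ω (r : ℂ)) (volume.restrict (Ioo 0 1)) := by
      apply aemeasurable_restrict_of_antitoneOn measurableSet_Ioo
      exact fun a ha b hb hab => hω.tail_antitone ha.1.le hab hb.2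
    fun_prop
  · calc ∫⁻ r in Ioc (node κ n) (node κ (n + 1)), ENNReal.ofReal (tail ω (r : ℂ) * (1 - r) ^ α)
        ≤ ∫⁻ r in Ioc (node κ n) (node κ (n + 1)),
            ENNReal.ofReal (tail ω (node κ n : ℂ) * (κ ^ n) ^ α) := by
          refine setLIntegral_mono' measurableSet_Ioc fun r hr => ?_
          have hk := one_sub_mem_of_mem_node hr
          have : 0 ≤ 1 - r := le_trans (by positivity) hk.1
          gcongr
          · exact (hω.tail_pos_coe (hn n) (hl n)).le
          · exact hω.tail_antitone (hn n) hr.1.le (hr.2.trans_lt (hl _))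
          · exact hk.2
      _ ≤ _ := by
          have h₂ := hω.tail_pos_coe (hn n) (hl n)
          rw [hcell, ← ENNReal.ofReal_mul (by positivity)]
          apply ENNReal.ofReal_le_ofReal
          have h₁ := hr.upper n
          calc tail ω (node κ n : ℂ) * (κ ^ n) ^ α * (κ ^ n * (1 - κ))
              ≤ C * tail ω (node κ (n + 1) : ℂ) * (κ ^ n) ^ α * (κ ^ n * (1 - κ)) := by gcongr
            _ = _ := by rw [hpow', hpow, pow_succ]; field_simp
  · have h₁ := hr.upper n
    have h₂ := hω.tail_pos_coe (hn (n + 1)) (hl (n + 1))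
    calc ENNReal.ofReal (tail ω (node κ n : ℂ) * (κ ^ n) ^ (α + 1))
        ≤ ENNReal.ofReal (C * tail ω (node κ (n + 1) : ℂ) * (κ ^ n) ^ (α + 1)) := by gcongr
      _ = ENNReal.ofReal (C * (κ ^ α)⁻¹ * (1 - κ)⁻¹) *
            ∫⁻ r in Ioc (node κ n) (node κ (n + 1)),
            ENNReal.ofReal (tail ω (node κ (n + 1) : ℂ) * (κ ^ (n + 1)) ^ α) := by
          rw [hcell, ← ENNReal.ofReal_mul (by positivity), ← ENNReal.ofReal_mul (by positivity),
            hpow', hpow]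
          congr 1
          field_simp
      _ ≤ _ := by
          refine mul_le_mul' le_rfl (setLIntegral_mono' measurableSet_Ioc fun r hr => ?_)
          have hk := one_sub_mem_of_mem_node hr
          gcongr
          · exact (hω.tail_pos_coe ((hn n).trans hr.1.le) (hr.2.trans_lt (hl _))).le
          · exact hω.tail_antitone ((hn n).trans hr.1.le) hr.2 (hl _)
          · exact hk.1

lemma cell_le_succ {ω : ℂ → ℝ} {κ c C α : ℝ} (hr : IsRatio ω κ c C) (n : ℕ) :
    cell ω κ α n ≤ ENNReal.ofReal (C / κ ^ α) * cell ω κ α (n + 1) := by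
  have h0 := hr.pos
  have hC := hr.const_pos
  have h₁ := hr.upper n
  have hκα : 0 < κ ^ α := Real.rpow_pos_of_pos h0 α
  have hpow : (κ ^ (n + 1)) ^ α = (κ ^ n) ^ α * κ ^ α := by
    rw [pow_succ, Real.mul_rpow (by positivity) h0.le]
  rw [cell, cell, ← ENNReal.ofReal_mul (by positivity)]
  apply ENNReal.ofReal_le_ofReal
  calc tail ω (node κ n : ℂ) * (κ ^ n) ^ α ≤ C * tail ω (node κ (n + 1) : ℂ) * (κ ^ n) ^ α := by
        gcongr
    _ = _ := by rw [hpow]; field_simp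

/-! ### A discrete Hardy inequality -/

/-- Convexity of `x ^ p`, applied to `a / w` and `b / (1 - w)` with weights `w` and `1 - w`, gives
the coefficients `w ^ (1 - p)` and `(1 - w) ^ (1 - p)`. -/
lemma exists_add_rpow_le {p s : ℝ} (hp : 1 < p) (hs : 1 < s) :
    ∃ C : ℝ≥0, ∀ a b : ℝ≥0∞, (a + b) ^ p ≤ ENNReal.ofReal s * a ^ p + C * b ^ p := by
  have hs0 : 0 < s := by linarith
  have scale : ∀ {w : ℝ}, 0 < w → ∀ z : ℝ≥0∞,
      ENNReal.ofReal w * (ENNReal.ofReal w⁻¹ * z) ^ p = ENNReal.ofReal (w ^ (1 - p)) * z ^ p := by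
    intro w hw z
    rw [ENNReal.mul_rpow_of_nonneg _ _ (by linarith), ← mul_assoc,
      ENNReal.ofReal_rpow_of_pos (by positivity), ← ENNReal.ofReal_mul hw.le,
      Real.inv_rpow hw.le, Real.rpow_sub hw, Real.rpow_one, div_eq_mul_inv]
  have cancel : ∀ {w : ℝ}, 0 < w → ∀ z : ℝ≥0∞,
      ENNReal.ofReal w * (ENNReal.ofReal w⁻¹ * z) = z := by
    intro w hw z
    rw [← mul_assoc, ← ENNReal.ofReal_mul hw.le, mul_inv_cancel₀ hw.ne', ENNReal.ofReal_one,
      one_mul]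
  -- The solution of `w ^ (1 - p) = s`; it is below `1` because `s > 1`.
  set w : ℝ := s ^ (-(p - 1)⁻¹) with hw
  have hw0 : 0 < w := Real.rpow_pos_of_pos hs0 _
  have hw1 : w < 1 := Real.rpow_lt_one_of_one_lt_of_neg hs
    (neg_lt_zero.2 (inv_pos.2 (by linarith)))
  have hws : w ^ (1 - p) = s := by
    rw [hw, ← Real.rpow_mul hs0.le]
    have : -(p - 1)⁻¹ * (1 - p) = 1 := by
      have : p - 1 ≠ 0 := by linarith
      field_simp
      ring
    rw [this, Real.rpow_one]
  refine ⟨((1 - w) ^ (1 - p)).toNNReal, fun a b => ?_⟩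
  have h := ENNReal.rpow_arith_mean_le_arith_mean2_rpow (ENNReal.ofReal w)
    (ENNReal.ofReal (1 - w)) (ENNReal.ofReal w⁻¹ * a) (ENNReal.ofReal (1 - w)⁻¹ * b)
    (by rw [← ENNReal.ofReal_add hw0.le (by linarith)]; simp) hp.le
  rwa [cancel hw0, cancel (by linarith), scale hw0, scale (by linarith), hws] at h

/-- A discrete Hardy inequality in recursive form. -/
lemma exists_hardy {p c : ℝ} (hp : 1 < p) (hc : 1 < c) :
    ∃ C : ℝ≥0, ∀ (T : ℕ → ℝ≥0∞) (X x : ℕ → ℝ≥0∞),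
      (∀ n, ENNReal.ofReal c * T (n + 1) ≤ T n) → (∀ n, X (n + 1) ≤ X n + x n) →
      ∑' n, X n ^ p * T n ≤ C * (X 0 ^ p * T 0 + ∑' n, x n ^ p * T n) := by
  have hc0 : 0 < c := by linarith
  -- The midpoint of `1` and `c` exceeds `1`, as convexity requires, yet is beaten by the decay
  -- `c⁻¹` of `T`: the product `θ` is a contraction factor.
  obtain ⟨C₀, hC₀⟩ := exists_add_rpow_le hp (s := (1 + c) / 2) (by linarith)
  set θ : ℝ := (1 + c) / 2 / c with hθ
  have hθ1 : θ < 1 := by rw [hθ, div_lt_one hc0]; linarith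
  have hθ0 : 0 < θ := by positivity
  have h1θ : 0 < 1 - θ := by linarith
  refine ⟨(1 - θ)⁻¹.toNNReal * (1 + C₀), fun T X x hT hX => ?_⟩
  set D : ℝ≥0∞ := X 0 ^ p * T 0 + C₀ * ∑' n, x n ^ p * T n with hD
  have hstep : ∀ n, X (n + 1) ^ p * T (n + 1) ≤
      ENNReal.ofReal θ * (X n ^ p * T n) + C₀ * (x n ^ p * T n) := fun n => by
    have hT' : T (n + 1) ≤ ENNReal.ofReal c⁻¹ * T n := by
      calc T (n + 1) = ENNReal.ofReal c⁻¹ * (ENNReal.ofReal c * T (n + 1)) := by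
            rw [← mul_assoc, ← ENNReal.ofReal_mul (by positivity), inv_mul_cancel₀ hc0.ne',
              ENNReal.ofReal_one, one_mul]
        _ ≤ _ := by gcongr; exact hT n
    have hc1 : ENNReal.ofReal c⁻¹ ≤ 1 := by
      rw [ENNReal.ofReal_le_one]; exact (inv_lt_one_of_one_lt₀ hc).le
    calc X (n + 1) ^ p * T (n + 1)
        ≤ (ENNReal.ofReal ((1 + c) / 2) * X n ^ p + C₀ * x n ^ p) *
            (ENNReal.ofReal c⁻¹ * T n) := by
          gcongr
          exact (ENNReal.rpow_le_rpow (hX n) (by linarith)).trans (hC₀ _ _)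
      _ = ENNReal.ofReal ((1 + c) / 2) * ENNReal.ofReal c⁻¹ * (X n ^ p * T n) +
            ENNReal.ofReal c⁻¹ * (C₀ * (x n ^ p * T n)) := by ring
      _ ≤ _ := by
          rw [← ENNReal.ofReal_mul (by positivity), ← div_eq_mul_inv]
          exact add_le_add le_rfl (mul_le_of_le_one_left' hc1)
  -- Absorbing `θ` times the full sum would need its finiteness. Induction on partial sums avoids
  -- this, since `D / (1 - θ)` is the fixed point of `S ↦ θ S + D`.
  have hpart : ∀ N, ∑ n ∈ Finset.range N, X n ^ p * T n ≤ ENNReal.ofReal (1 - θ)⁻¹ * D := by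
    intro N
    induction N with
    | zero => simp
    | succ N ih =>
      rw [Finset.sum_range_succ']
      calc ∑ n ∈ Finset.range N, X (n + 1) ^ p * T (n + 1) + X 0 ^ p * T 0
          ≤ ∑ n ∈ Finset.range N, (ENNReal.ofReal θ * (X n ^ p * T n) + C₀ * (x n ^ p * T n)) +
              X 0 ^ p * T 0 := by gcongr with n; exact hstep n
        _ = ENNReal.ofReal θ * ∑ n ∈ Finset.range N, X n ^ p * T n +
              (X 0 ^ p * T 0 + C₀ * ∑ n ∈ Finset.range N, x n ^ p * T n) := by
            rw [Finset.sum_add_distrib, ← Finset.mul_sum, ← Finset.mul_sum]; ring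
        _ ≤ ENNReal.ofReal θ * (ENNReal.ofReal (1 - θ)⁻¹ * D) + D := by
            refine add_le_add (mul_le_mul' le_rfl ih) (add_le_add le_rfl (mul_le_mul' le_rfl ?_))
            exact ENNReal.sum_le_tsum _
        _ = (ENNReal.ofReal (θ * (1 - θ)⁻¹) + ENNReal.ofReal 1) * D := by
            rw [ENNReal.ofReal_mul hθ0.le, ENNReal.ofReal_one]; ring
        _ = _ := by
            rw [← ENNReal.ofReal_add (by positivity) zero_le_one]
            congr 2
            field_simp
            ring
  rw [ENNReal.tsum_eq_iSup_nat]
  refine (iSup_le hpart).trans ?_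
  rw [ENNReal.coe_mul, mul_assoc]
  refine mul_le_mul' le_rfl ?_
  calc D ≤ (1 + C₀) * (X 0 ^ p * T 0) + (1 + C₀) * ∑' n, x n ^ p * T n := by
        rw [hD]
        exact add_le_add (le_mul_of_one_le_left' le_self_add) (mul_le_mul' le_add_self le_rfl)
    _ = _ := by push_cast; ring

/-! ### Maximum modulus -/

/-- The maximum modulus principle, together with a finite real value for `maxModulus`. Radius `0` is
separate because the closure of an empty ball is not the closed ball. -/
lemma exists_maxModulus {g : ℂ → ℂ} (hg : DifferentiableOn ℂ g disc) {r : ℝ} (hr : 0 ≤ r)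
    (hr1 : r < 1) :
    ∃ M : ℝ, 0 ≤ M ∧ maxModulus r g = ENNReal.ofReal M ∧ ∀ z, ‖z‖ ≤ r → ‖g z‖ ≤ M := by
  have hsub : Metric.closedBall (0 : ℂ) r ⊆ disc := Metric.closedBall_subset_ball hr1
  have hcont : ContinuousOn g (Metric.sphere 0 r) :=
    hg.continuousOn.mono (Metric.sphere_subset_closedBall.trans hsub)
  obtain ⟨B, hB⟩ := (isCompact_sphere (0 : ℂ) r).exists_bound_of_continuousOn hcont
  have htop : maxModulus r g ≠ ∞ := by
    refine ne_top_of_le_ne_top (ENNReal.ofReal_ne_top (r := B)) (iSup₂_le fun z hz => ?_)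
    rw [← ofReal_norm]
    exact ENNReal.ofReal_le_ofReal (hB z hz)
  have hM : ∀ z ∈ Metric.sphere (0 : ℂ) r, ‖g z‖ ≤ (maxModulus r g).toReal := fun z hz => by
    rw [← toReal_enorm]
    exact ENNReal.toReal_mono htop (le_iSup₂ (f := fun z _ => ‖g z‖ₑ) z hz)
  refine ⟨(maxModulus r g).toReal, ENNReal.toReal_nonneg, (ENNReal.ofReal_toReal htop).symm,
    fun z hz => ?_⟩
  rcases hr.eq_or_lt with rfl | hr0
  · exact hM z (by simpa using le_antisymm hz (norm_nonneg z))
  · refine Complex.norm_le_of_forall_mem_frontier_norm_le (U := Metric.ball 0 r)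
      Metric.isBounded_ball ((hg.mono ?_).diffContOnCl) (fun w hw => hM w ?_) ?_
    · rwa [closure_ball _ hr0.ne']
    · rwa [frontier_ball _ hr0.ne'] at hw
    · rw [closure_ball _ hr0.ne']; simpa using hz

lemma enorm_le_maxModulus {g : ℂ → ℂ} (hg : DifferentiableOn ℂ g disc) {r : ℝ} (hr : 0 ≤ r)
    (hr1 : r < 1) {z : ℂ} (hz : ‖z‖ ≤ r) : ‖g z‖ₑ ≤ maxModulus r g := by
  obtain ⟨M, -, hM, h⟩ := exists_maxModulus hg hr hr1
  rw [hM, ← ofReal_norm]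
  exact ENNReal.ofReal_le_ofReal (h z hz)

lemma maxModulus_monotoneOn {g : ℂ → ℂ} (hg : DifferentiableOn ℂ g disc) :
    MonotoneOn (fun r => maxModulus r g) (Ico 0 1) := fun _ _ _ hb hab =>
  iSup₂_le fun _ hz => enorm_le_maxModulus hg hb.1 hb.2
    ((mem_sphere_zero_iff_norm.1 hz).le.trans hab)

lemma maxModulus_zero (g : ℂ → ℂ) : maxModulus 0 g = ‖g 0‖ₑ := by
  simp [maxModulus]

lemma differentiableOn_deriv {f : ℂ → ℂ} (hf : DifferentiableOn ℂ f disc) :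
    DifferentiableOn ℂ (deriv f) disc := hf.deriv Metric.isOpen_ball

/-- The mean value inequality on the radial segment from `w`, of modulus `r`, to `z`, of modulus
`ρ`. This supplies the increments for the Hardy inequality. -/
lemma maxModulus_le_add {f : ℂ → ℂ} (hf : DifferentiableOn ℂ f disc) {r ρ : ℝ} (hr : 0 ≤ r)
    (hrρ : r ≤ ρ) (hρ : ρ < 1) :
    maxModulus ρ f ≤ maxModulus r f + ENNReal.ofReal (ρ - r) * maxModulus ρ (deriv f) := by
  obtain ⟨M, hM0, hM, hMb⟩ := exists_maxModulus (differentiableOn_deriv hf) (hr.trans hrρ) hρ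
  refine iSup₂_le fun z hz => ?_
  have hz : ‖z‖ = ρ := mem_sphere_zero_iff_norm.1 hz
  set w : ℂ := ((r / ρ : ℝ) : ℂ) * z with hw
  have hq0 : 0 ≤ r / ρ := div_nonneg hr (hr.trans hrρ)
  have hq1 : r / ρ ≤ 1 := div_le_one_of_le₀ hrρ (hr.trans hrρ)
  have hρr : r / ρ * ρ = r := by
    -- For `ρ = 0` also `r = 0`, and the convention `r / 0 = 0` is harmless.
    rcases (hr.trans hrρ).eq_or_lt with h | h
    · subst h; simp; linarith
    · field_simp
  have hwn : ‖w‖ = r := by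
    rw [hw, norm_mul, hz, norm_coe_of_nonneg hq0, hρr]
  have hzw : ‖z - w‖ = ρ - r := by
    have : z - w = ((1 - r / ρ : ℝ) : ℂ) * z := by rw [hw]; push_cast; ring
    rw [this, norm_mul, norm_coe_of_nonneg (by linarith), hz, sub_mul, hρr, one_mul]
  have hmv : ‖f z - f w‖ ≤ M * ‖z - w‖ := by
    refine Convex.norm_image_sub_le_of_norm_deriv_le (s := Metric.closedBall (0 : ℂ) ρ)
      (fun x hx => ?_) (fun x hx => hMb x (by simpa using hx)) (convex_closedBall _ _) ?_ ?_
    · exact hf.differentiableAt (Metric.isOpen_ball.mem_nhds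
        (Metric.closedBall_subset_ball hρ hx))
    · simp [hwn, hrρ]
    · simp [hz]
  calc ‖f z‖ₑ = ‖f w + (f z - f w)‖ₑ := by congr 1; ring
    _ ≤ ‖f w‖ₑ + ‖f z - f w‖ₑ := enorm_add_le _ _
    _ ≤ maxModulus r f + ENNReal.ofReal (ρ - r) * maxModulus ρ (deriv f) := by
        gcongr
        · exact enorm_le_maxModulus hf hr (hrρ.trans_lt hρ) hwn.le
        · rw [hM, ← ENNReal.ofReal_mul (by linarith), ← ofReal_norm]
          apply ENNReal.ofReal_le_ofReal
          rw [hzw] at hmv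
          linarith

/-! ### Circle means -/

/-- The mean of `|g| ^ q` over the circle of radius `r`. -/
noncomputable def circleMean (q r : ℝ) (g : ℂ → ℂ) : ℝ≥0∞ :=
  (ENNReal.ofReal (2 * Real.pi))⁻¹ *
    ∫⁻ θ in Ioo 0 (2 * Real.pi), ‖g (circleMap 0 r θ)‖ₑ ^ q

lemma continuous_comp_circleMap {E : Type*} [TopologicalSpace E] {g : ℂ → E}
    (hg : ContinuousOn g disc) {r : ℝ} (hr : 0 ≤ r) (hr1 : r < 1) :
    Continuous fun θ => g (circleMap 0 r θ) :=
  hg.comp_continuous (continuous_circleMap 0 r) fun θ => by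
    simpa [abs_of_nonneg hr] using hr1

lemma ofReal_two_pi_ne_zero : ENNReal.ofReal (2 * Real.pi) ≠ 0 := by
  simp [Real.pi_pos]

/-- The Poisson kernel between the circles of radii `r` and `ρ`. -/
noncomputable def poissonCircle (r ρ φ θ : ℝ) : ℝ :=
  poissonKernel 0 (circleMap 0 r φ) (circleMap 0 ρ θ)

lemma normSq_circleMap_sub (r ρ φ θ : ℝ) :
    ‖circleMap 0 ρ θ - circleMap 0 r φ‖ ^ 2 =
      ρ ^ 2 + r ^ 2 - 2 * ρ * r * Real.cos (θ - φ) := by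
  rw [← Complex.normSq_eq_norm_sq, circleMap_zero, circleMap_zero, Complex.exp_mul_I,
    Complex.exp_mul_I, ← Complex.ofReal_cos, ← Complex.ofReal_cos, ← Complex.ofReal_sin,
    ← Complex.ofReal_sin, Complex.normSq_apply, Real.cos_sub]
  simp [-Complex.ofReal_cos, -Complex.ofReal_sin]
  linear_combination (ρ ^ 2) * Real.sin_sq_add_cos_sq θ + r ^ 2 * Real.sin_sq_add_cos_sq φ

lemma poissonCircle_eq (r ρ φ θ : ℝ) : poissonCircle r ρ φ θ =
    (ρ ^ 2 - r ^ 2) / (ρ ^ 2 + r ^ 2 - 2 * ρ * r * Real.cos (θ - φ)) := by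
  rw [poissonCircle, poissonKernel_def]
  simp only [sub_zero]
  rw [normSq_circleMap_sub]
  simp

lemma poissonCircle_comm (r ρ φ θ : ℝ) : poissonCircle r ρ φ θ = poissonCircle r ρ θ φ := by
  rw [poissonCircle_eq, poissonCircle_eq, ← Real.cos_neg, neg_sub]

lemma poissonCircle_den_pos {r ρ : ℝ} (hr : 0 ≤ r) (hρ : r < ρ) (t : ℝ) :
    (ρ - r) ^ 2 ≤ ρ ^ 2 + r ^ 2 - 2 * ρ * r * Real.cos t := by
  nlinarith [mul_nonneg (mul_nonneg hr (hr.trans hρ.le)) (sub_nonneg.2 (Real.cos_le_one t))]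

lemma poissonCircle_nonneg {r ρ : ℝ} (hr : 0 ≤ r) (hρ : r < ρ) (φ θ : ℝ) :
    0 ≤ poissonCircle r ρ φ θ := by
  rw [poissonCircle_eq]
  have := poissonCircle_den_pos hr hρ (θ - φ)
  exact div_nonneg (by nlinarith) (by nlinarith)

/-- The kernel is at most `(ρ + r) / (ρ - r)`, and `ρ + r < 2`. -/
lemma poissonCircle_le {r ρ : ℝ} (hr : 0 ≤ r) (hρ : r < ρ) (hρ1 : ρ < 1) (φ θ : ℝ) :
    poissonCircle r ρ φ θ ≤ 2 / (ρ - r) := by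
  rw [poissonCircle_eq]
  have h := poissonCircle_den_pos hr hρ (θ - φ)
  have h' : 0 < ρ - r := by linarith
  have h'' : 0 < (ρ - r) ^ 2 := by positivity
  rw [div_le_div_iff₀ (by linarith) h']
  nlinarith

lemma continuous_poissonCircle {r ρ : ℝ} (hr : 0 ≤ r) (hρ : r < ρ) :
    Continuous fun x : ℝ × ℝ => poissonCircle r ρ x.1 x.2 := by
  simp_rw [poissonCircle_eq]
  refine Continuous.div (by fun_prop) (by fun_prop) fun x => ?_
  have := poissonCircle_den_pos hr hρ (x.2 - x.1)
  have h' : 0 < (ρ - r) ^ 2 := pow_pos (sub_pos.2 hρ) 2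
  linarith

lemma continuous_poissonCircle_right {r ρ : ℝ} (hr : 0 ≤ r) (hρ : r < ρ) (φ : ℝ) :
    Continuous (poissonCircle r ρ φ) := by
  have h := (continuous_poissonCircle hr hρ).comp (Continuous.prodMk_right φ)
  exact h

lemma intervalIntegral_poissonCircle_smul {g : ℂ → ℂ} (hg : DifferentiableOn ℂ g disc) {r ρ : ℝ}
    (hr : 0 ≤ r) (hρ : r < ρ) (hρ1 : ρ < 1) (φ : ℝ) :
    g (circleMap 0 r φ) = (2 * Real.pi)⁻¹ •
      ∫ θ in 0..2 * Real.pi, poissonCircle r ρ φ θ • g (circleMap 0 ρ θ) := by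
  have hρ0 : ρ ≠ 0 := by linarith
  have h := DiffContOnCl.circleAverage_poissonKernel_smul (c := 0) (R := ρ)
    (w := circleMap 0 r φ) (f := g) ?_ ?_
  · rw [← h]; rfl
  · refine (hg.mono ?_).diffContOnCl
    rw [closure_ball _ hρ0]
    exact Metric.closedBall_subset_ball hρ1
  · simpa [abs_of_nonneg hr] using hρ

lemma lintegral_poissonCircle {r ρ : ℝ} (hr : 0 ≤ r) (hρ : r < ρ) (hρ1 : ρ < 1) (φ : ℝ) :
    ∫⁻ θ in Ioo 0 (2 * Real.pi), ENNReal.ofReal (poissonCircle r ρ φ θ) =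
      ENNReal.ofReal (2 * Real.pi) := by
  have h := intervalIntegral_poissonCircle_smul (g := fun _ => 1) (differentiableOn_const 1)
    hr hρ hρ1 φ
  have hc := continuous_poissonCircle_right hr hρ φ
  have h2 : ∫ θ in 0..2 * Real.pi, poissonCircle r ρ φ θ = 2 * Real.pi := by
    simp only [Complex.real_smul, mul_one] at h
    rw [intervalIntegral.integral_ofReal] at h
    have h3 : (1 : ℝ) = (2 * Real.pi)⁻¹ * ∫ θ in 0..2 * Real.pi, poissonCircle r ρ φ θ := by
      exact_mod_cast h
    have := Real.pi_pos
    field_simp at h3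
    linarith
  conv_rhs => rw [← h2, intervalIntegral.integral_of_le (by positivity)]
  rw [restrict_Ioo_eq_restrict_Ioc, ofReal_integral_eq_lintegral_ofReal]
  · exact (hc.intervalIntegrable 0 (2 * Real.pi)).1
  · exact Filter.Eventually.of_forall fun θ => poissonCircle_nonneg hr hρ φ θ

/-- Jensen's inequality for the Poisson representation of `g`, the kernel being a probability
density with respect to `dθ / 2π`. -/
lemma enorm_rpow_le_poisson {g : ℂ → ℂ} (hg : DifferentiableOn ℂ g disc) {q r ρ : ℝ}
    (hq : 1 < q) (hr : 0 ≤ r) (hρ : r < ρ) (hρ1 : ρ < 1) (φ : ℝ) :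
    ‖g (circleMap 0 r φ)‖ₑ ^ q ≤ (ENNReal.ofReal (2 * Real.pi))⁻¹ *
      ∫⁻ θ in Ioo 0 (2 * Real.pi),
        ENNReal.ofReal (poissonCircle r ρ φ θ) * ‖g (circleMap 0 ρ θ)‖ₑ ^ q := by
  set P : ℝ → ℝ≥0∞ := fun θ => ENNReal.ofReal (poissonCircle r ρ φ θ) with hP
  set N : ℝ → ℝ≥0∞ := fun θ => ‖g (circleMap 0 ρ θ)‖ₑ with hN
  have hcN : Measurable N :=
    (continuous_comp_circleMap hg.continuousOn (hr.trans hρ.le) hρ1).enorm.measurable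
  have hcP : Measurable P :=
    (continuous_poissonCircle_right hr hρ φ).measurable.ennreal_ofReal
  set c := ENNReal.ofReal (2 * Real.pi) with hc
  have hc0 : c ≠ 0 := ofReal_two_pi_ne_zero
  have hct : c ≠ ∞ := ENNReal.ofReal_ne_top
  have h1 : ‖g (circleMap 0 r φ)‖ₑ ≤ c⁻¹ * ∫⁻ θ in Ioo 0 (2 * Real.pi), P θ * N θ := by
    have := Real.pi_pos
    rw [intervalIntegral_poissonCircle_smul hg hr hρ hρ1 φ,
      intervalIntegral.integral_of_le (by positivity), restrict_Ioo_eq_restrict_Ioc, enorm_smul]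
    refine mul_le_mul' ?_ ((enorm_integral_le_lintegral_enorm _).trans (lintegral_mono fun θ => ?_))
    · rw [Real.enorm_eq_ofReal (by positivity), ENNReal.ofReal_inv_of_pos (by positivity)]
    · rw [enorm_smul, Real.enorm_eq_ofReal (poissonCircle_nonneg hr hρ φ θ)]
  have hq0 : 0 < q := by linarith
  have hconj : (q.conjExponent).HolderConjugate q := (Real.HolderConjugate.conjExponent hq).symm
  set q' := q.conjExponent with hq'
  have h2 : ∫⁻ θ in Ioo 0 (2 * Real.pi), P θ * N θ ≤
      c ^ (1 / q') * (∫⁻ θ in Ioo 0 (2 * Real.pi), P θ * N θ ^ q) ^ (1 / q) := by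
    -- Jensen is obtained from Hölder by splitting `P * N` as `P ^ (1 / q')` times `P ^ (1 / q) *
    -- N`.
    have := ENNReal.lintegral_mul_le_Lp_mul_Lq (volume.restrict (Ioo 0 (2 * Real.pi))) hconj
      (f := fun θ => P θ ^ (1 / q')) (g := fun θ => P θ ^ (1 / q) * N θ)
      (hcP.pow_const _).aemeasurable ((hcP.pow_const _).mul hcN).aemeasurable
    have hadd : 1 / q' + 1 / q = 1 := by
      rw [one_div, one_div]; exact hconj.inv_add_inv_eq_one
    have e1 : ∀ θ, P θ ^ (1 / q') * (P θ ^ (1 / q) * N θ) = P θ * N θ := fun θ => by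
      rw [← mul_assoc, ← ENNReal.rpow_add_of_nonneg _ _ (by simpa using hconj.nonneg)
        (by simpa using hq0.le), hadd, ENNReal.rpow_one]
    have e2 : ∀ θ, (P θ ^ (1 / q')) ^ q' = P θ := fun θ => by
      rw [← ENNReal.rpow_mul, one_div_mul_cancel hconj.ne_zero, ENNReal.rpow_one]
    have e3 : ∀ θ, (P θ ^ (1 / q) * N θ) ^ q = P θ * N θ ^ q := fun θ => by
      rw [ENNReal.mul_rpow_of_nonneg _ _ hq0.le, ← ENNReal.rpow_mul,
        one_div_mul_cancel hq0.ne', ENNReal.rpow_one]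
    simp only [Pi.mul_apply, e1, e2, e3] at this
    rwa [hP, lintegral_poissonCircle hr hρ hρ1 φ] at this
  calc ‖g (circleMap 0 r φ)‖ₑ ^ q
      ≤ (c⁻¹ * (c ^ (1 / q') * (∫⁻ θ in Ioo 0 (2 * Real.pi), P θ * N θ ^ q) ^ (1 / q))) ^ q := by
        gcongr
        exact h1.trans (mul_le_mul' le_rfl h2)
    _ = (c⁻¹ * c ^ (1 / q')) ^ q * ∫⁻ θ in Ioo 0 (2 * Real.pi), P θ * N θ ^ q := by
        rw [← mul_assoc, ENNReal.mul_rpow_of_nonneg _ _ hq0.le, ← ENNReal.rpow_mul,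
          one_div_mul_cancel hq0.ne', ENNReal.rpow_one]
    _ = _ := by
        congr 1
        rw [← ENNReal.rpow_neg_one, ← ENNReal.rpow_add _ _ hc0 hct, ← ENNReal.rpow_mul]
        congr 1
        have : q'⁻¹ + q⁻¹ = 1 := hconj.inv_add_inv_eq_one
        have h5 : q'⁻¹ = 1 - q⁻¹ := by linarith
        rw [one_div, h5]
        field_simp
        ring

lemma maxModulus_rpow_le {g : ℂ → ℂ} (hg : DifferentiableOn ℂ g disc) {q r ρ : ℝ}
    (hq : 1 < q) (hr : 0 ≤ r) (hρ : r < ρ) (hρ1 : ρ < 1) :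
    maxModulus r g ^ q ≤ ENNReal.ofReal (2 / (ρ - r)) * circleMean q ρ g := by
  have hq0 : 0 < q := by linarith
  rw [← ENNReal.le_rpow_inv_iff hq0]
  refine iSup₂_le fun z hz => ?_
  rw [ENNReal.le_rpow_inv_iff hq0]
  have hz : z = circleMap 0 r z.arg := by
    rw [circleMap_zero, ← mem_sphere_zero_iff_norm.1 hz, Complex.norm_mul_exp_arg_mul_I]
  rw [hz]
  refine (enorm_rpow_le_poisson hg hq hr hρ hρ1 z.arg).trans ?_
  rw [circleMean, mul_left_comm]
  refine mul_le_mul' le_rfl ?_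
  rw [← lintegral_const_mul' _ _ ENNReal.ofReal_ne_top]
  refine lintegral_mono fun θ => ?_
  exact mul_le_mul' (ENNReal.ofReal_le_ofReal (poissonCircle_le hr hρ hρ1 _ θ)) le_rfl

/-- Integrate the Poisson bound over the smaller circle and exchange the integrals. The kernel is
symmetric in its angles, so its integral in `φ` is again `2π`. -/
lemma circleMean_monotoneOn {g : ℂ → ℂ} (hg : DifferentiableOn ℂ g disc) {q : ℝ} (hq : 1 < q) :
    MonotoneOn (fun r => circleMean q r g) (Ico 0 1) := by
  intro r hr ρ hρ hrρ
  rcases hrρ.eq_or_lt with rfl | hlt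
  · exact le_rfl
  have hm := (continuous_comp_circleMap hg.continuousOn hρ.1 hρ.2).enorm.measurable.pow_const q
  have hP : Measurable fun x : ℝ × ℝ => ENNReal.ofReal (poissonCircle r ρ x.1 x.2) :=
    (continuous_poissonCircle hr.1 hlt).measurable.ennreal_ofReal
  set c := ENNReal.ofReal (2 * Real.pi) with hc
  refine mul_le_mul' le_rfl ?_
  calc ∫⁻ φ in Ioo 0 (2 * Real.pi), ‖g (circleMap 0 r φ)‖ₑ ^ q
      ≤ ∫⁻ φ in Ioo 0 (2 * Real.pi), c⁻¹ * ∫⁻ θ in Ioo 0 (2 * Real.pi),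
          ENNReal.ofReal (poissonCircle r ρ φ θ) * ‖g (circleMap 0 ρ θ)‖ₑ ^ q :=
        lintegral_mono fun φ => enorm_rpow_le_poisson hg hq hr.1 hlt hρ.2 φ
    _ = c⁻¹ * ∫⁻ θ in Ioo 0 (2 * Real.pi), ∫⁻ φ in Ioo 0 (2 * Real.pi),
          ENNReal.ofReal (poissonCircle r ρ φ θ) * ‖g (circleMap 0 ρ θ)‖ₑ ^ q := by
        rw [lintegral_const_mul' _ _ (ENNReal.inv_ne_top.2 ofReal_two_pi_ne_zero),
          lintegral_lintegral_swap]
        exact (hP.mul (hm.comp measurable_snd)).aemeasurable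
    _ = c⁻¹ * ∫⁻ θ in Ioo 0 (2 * Real.pi), c * ‖g (circleMap 0 ρ θ)‖ₑ ^ q := by
        congr 1
        refine lintegral_congr fun θ => ?_
        simp_rw [poissonCircle_comm r ρ _ θ]
        rw [lintegral_mul_const _
            (continuous_poissonCircle_right hr.1 hlt θ).measurable.ennreal_ofReal,
          lintegral_poissonCircle hr.1 hlt hρ.2]
    _ = _ := by
        rw [lintegral_const_mul' _ _ ENNReal.ofReal_ne_top, ← mul_assoc,
          ENNReal.inv_mul_cancel ofReal_two_pi_ne_zero ENNReal.ofReal_ne_top, one_mul]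

/-! ### Polar coordinates and the area of the image -/

lemma setLIntegral_neg_pi_pi {F : ℝ → ℝ≥0∞} (hF : Function.Periodic F (2 * Real.pi)) :
    ∫⁻ θ in Ioo (-Real.pi) Real.pi, F θ = ∫⁻ θ in Ioo 0 (2 * Real.pi), F θ := by
  have : VAddInvariantMeasure (AddSubgroup.zmultiples (2 * Real.pi)) ℝ volume :=
    ⟨fun c s _ => measure_preimage_add _ _ _⟩
  have h := IsAddFundamentalDomain.setLIntegral_eq (G := AddSubgroup.zmultiples (2 * Real.pi))
    (isAddFundamentalDomain_Ioc Real.two_pi_pos (-Real.pi))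
    (isAddFundamentalDomain_Ioc Real.two_pi_pos 0) F hF.map_vadd_zmultiples
  rw [restrict_Ioo_eq_restrict_Ioc, restrict_Ioo_eq_restrict_Ioc]
  rwa [show -Real.pi + 2 * Real.pi = Real.pi by ring, zero_add] at h

lemma lintegral_ball_polar {R : ℝ} {H : ℂ → ℝ≥0∞} (hH : ContinuousOn H (Metric.ball 0 R))
    {ν : ℝ → ℝ≥0∞} (hν : AEMeasurable ν (volume.restrict (Ioo 0 R))) :
    ∫⁻ z in Metric.ball 0 R, H z * ν ‖z‖ =
      ∫⁻ r in Ioo 0 R,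
        ENNReal.ofReal r * (∫⁻ θ in Ioo 0 (2 * Real.pi), H (circleMap 0 r θ)) * ν r := by
  have hsymm : ∀ x : ℝ × ℝ, Complex.polarCoord.symm x = circleMap 0 x.1 x.2 := fun x => by
    rw [Complex.polarCoord_symm_apply, circleMap_zero, Complex.exp_mul_I]
    push_cast; ring
  have hHm : AEMeasurable (fun x : ℝ × ℝ => H (circleMap 0 x.1 x.2))
      (volume.restrict (Ioo 0 R ×ˢ Ioo (-Real.pi) Real.pi)) := by
    refine ContinuousOn.aemeasurable (hH.comp ?_ fun x hx => ?_)
      (measurableSet_Ioo.prod measurableSet_Ioo)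
    · simp only [circleMap_zero]; fun_prop
    · simpa [abs_of_pos hx.1.1] using hx.1.2
  have hνm : AEMeasurable (fun x : ℝ × ℝ => ν x.1)
      (volume.restrict (Ioo 0 R ×ˢ Ioo (-Real.pi) Real.pi)) := by
    rw [Measure.volume_eq_prod, ← Measure.prod_restrict]
    exact hν.comp_fst
  calc ∫⁻ z in Metric.ball 0 R, H z * ν ‖z‖
      = ∫⁻ x in polarCoord.target, ENNReal.ofReal x.1 •
          (Metric.ball (0 : ℂ) R).indicator (fun z => H z * ν ‖z‖) (Complex.polarCoord.symm x) := by
        rw [Complex.lintegral_comp_polarCoord_symm,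
          lintegral_indicator Metric.isOpen_ball.measurableSet]
    _ = ∫⁻ x in polarCoord.target, (Ioo 0 R ×ˢ Ioo (-Real.pi) Real.pi).indicator
          (fun x => ENNReal.ofReal x.1 * (H (circleMap 0 x.1 x.2) * ν x.1)) x := by
        refine setLIntegral_congr_fun polarCoord.open_target.measurableSet fun x hx => ?_
        have hx0 : 0 < x.1 := hx.1
        have hn : ‖circleMap 0 x.1 x.2‖ = x.1 := by simp [abs_of_pos hx0]
        simp only [hsymm, smul_eq_mul]
        by_cases hR : x.1 < R
        · rw [indicator_of_mem (by simpa [abs_of_pos hx0] using hR),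
            indicator_of_mem (show x ∈ Ioo 0 R ×ˢ Ioo (-Real.pi) Real.pi from
              ⟨⟨hx0, hR⟩, hx.2⟩), hn]
        · rw [indicator_of_notMem (by simpa [abs_of_pos hx0] using hR),
            indicator_of_notMem (fun h => hR h.1.2), mul_zero]
    _ = ∫⁻ x in Ioo 0 R ×ˢ Ioo (-Real.pi) Real.pi,
          ENNReal.ofReal x.1 * (H (circleMap 0 x.1 x.2) * ν x.1) := by
        have hsub : Ioo 0 R ×ˢ Ioo (-Real.pi) Real.pi ⊆ polarCoord.target :=
          fun x hx => ⟨hx.1.1, hx.2⟩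
        rw [setLIntegral_indicator (measurableSet_Ioo.prod measurableSet_Ioo),
          inter_eq_left.2 hsub]
    _ = ∫⁻ r in Ioo 0 R, ∫⁻ θ in Ioo (-Real.pi) Real.pi,
          ENNReal.ofReal r * (H (circleMap 0 r θ) * ν r) := by
        rw [Measure.volume_eq_prod, setLIntegral_prod]
        exact (by fun_prop : Measurable fun x : ℝ × ℝ => ENNReal.ofReal x.1).aemeasurable.mul
          (hHm.mul hνm)
    _ = _ := by
        refine setLIntegral_congr_fun measurableSet_Ioo fun r hr => ?_
        have hm : Measurable fun θ => H (circleMap 0 r θ) :=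
          (hH.comp_continuous (continuous_circleMap 0 r) fun θ => by
            simpa [abs_of_pos hr.1] using hr.2).measurable
        rw [lintegral_const_mul' _ _ ENNReal.ofReal_ne_top, lintegral_mul_const _ hm,
          setLIntegral_neg_pi_pi, mul_assoc]
        intro θ
        simp only [periodic_circleMap 0 r θ]

lemma lintegral_circle_eq (q r : ℝ) (g : ℂ → ℂ) :
    ∫⁻ θ in Ioo 0 (2 * Real.pi), ‖g (circleMap 0 r θ)‖ₑ ^ q =
      ENNReal.ofReal (2 * Real.pi) * circleMean q r g := by
  rw [circleMean, ← mul_assoc, ENNReal.mul_inv_cancel ofReal_two_pi_ne_zero ENNReal.ofReal_ne_top,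
    one_mul]

/-- The real Jacobian of `f` is `|f'| ^ 2`, so by injectivity the integral equals the area of the
image, which lies in a disc of radius the maximum modulus. Injectivity is used nowhere else. -/
lemma lintegral_enorm_deriv_sq_le {f : ℂ → ℂ} (hf : f ∈ univalent) {ρ : ℝ} (hρ : 0 ≤ ρ)
    (hρ1 : ρ < 1) :
    ∫⁻ z in Metric.ball 0 ρ, ‖deriv f z‖ₑ ^ (2 : ℝ) ≤
      ENNReal.ofReal Real.pi * maxModulus ρ f ^ (2 : ℝ) := by
  obtain ⟨M, hM0, hM, hMb⟩ := exists_maxModulus hf.1 hρ hρ1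
  have hsub : Metric.ball (0 : ℂ) ρ ⊆ disc := Metric.ball_subset_ball hρ1.le
  have hdet : ∀ a : ℂ, |((ContinuousLinearMap.toSpanSingleton ℂ a).restrictScalars ℝ).det| =
      ‖a‖ ^ 2 := fun a => by
    simp [ContinuousLinearMap.det, LinearMap.det_restrictScalars, Algebra.norm_complex_eq,
      Complex.normSq_eq_norm_sq]
  have h := lintegral_abs_det_fderiv_eq_addHaar_image volume
    (f' := fun z => (ContinuousLinearMap.toSpanSingleton ℂ (deriv f z)).restrictScalars ℝ)
    (Metric.isOpen_ball (x := (0 : ℂ)) (ε := ρ)).measurableSet (fun z hz =>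
      ((hf.1.differentiableAt (Metric.isOpen_ball.mem_nhds (hsub hz))).hasDerivAt.hasFDerivAt
        |>.restrictScalars ℝ).hasFDerivWithinAt) (hf.2.mono hsub)
  simp only [hdet] at h
  calc ∫⁻ z in Metric.ball 0 ρ, ‖deriv f z‖ₑ ^ (2 : ℝ)
      = ∫⁻ z in Metric.ball 0 ρ, ENNReal.ofReal (‖deriv f z‖ ^ 2) := by
        refine lintegral_congr fun z => ?_
        rw [← ofReal_norm, ENNReal.rpow_ofNat, ENNReal.ofReal_pow (norm_nonneg _)]
    _ = volume (f '' Metric.ball 0 ρ) := h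
    _ ≤ volume (Metric.closedBall (0 : ℂ) M) := by
        refine measure_mono ?_
        rintro _ ⟨z, hz, rfl⟩
        simpa using hMb z (by simpa using (mem_ball_zero_iff.1 hz).le)
    _ = _ := by
        rw [Complex.volume_closedBall, hM, ENNReal.rpow_ofNat, mul_comm]
        congr 1
        rw [ENNReal.ofReal, ← NNReal.coe_real_pi, Real.toNNReal_coe]

/-- Cauchy's estimate on the disc of radius `ρ - r` about a point of modulus `r`. -/
lemma maxModulus_deriv_le {f : ℂ → ℂ} (hf : DifferentiableOn ℂ f disc) {r ρ : ℝ} (hr : 0 ≤ r)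
    (hrρ : r < ρ) (hρ1 : ρ < 1) :
    maxModulus r (deriv f) ≤ ENNReal.ofReal (ρ - r)⁻¹ * maxModulus ρ f := by
  obtain ⟨M, hM0, hM, hMb⟩ := exists_maxModulus hf (hr.trans hrρ.le) hρ1
  have hδ : 0 < ρ - r := by linarith
  refine iSup₂_le fun z hz => ?_
  have hz : ‖z‖ = r := mem_sphere_zero_iff_norm.1 hz
  have hball : ∀ w ∈ Metric.closedBall z (ρ - r), ‖w‖ ≤ ρ := fun w hw => by
    have h1 : ‖w - z‖ ≤ ρ - r := by simpa [dist_eq_norm] using hw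
    have h2 := norm_add_le z (w - z)
    rw [add_sub_cancel, hz] at h2
    linarith
  have h := Complex.norm_deriv_le_of_forall_mem_sphere_norm_le (c := z) (f := f) (C := M) hδ ?_
    fun w hw => hMb w (hball w (Metric.sphere_subset_closedBall hw))
  · rw [hM, ← ENNReal.ofReal_mul (by positivity), ← ofReal_norm]
    apply ENNReal.ofReal_le_ofReal
    rwa [inv_mul_eq_div]
  · refine (hf.mono fun w hw => ?_).diffContOnCl
    rw [closure_ball _ hδ.ne'] at hw
    exact mem_ball_zero_iff.2 ((hball w hw).trans_lt hρ1)

/-- Restrict the area integral to the annulus `r < |z| < ρ`, where the means are at least the one at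
`r`. The factor `r⁻¹` comes from the polar Jacobian and stays bounded at the nodes from index `1`
on. -/
lemma circleMean_two_deriv_le {f : ℂ → ℂ} (hf : f ∈ univalent) {r ρ : ℝ} (hr : 0 < r)
    (hrρ : r < ρ) (hρ1 : ρ < 1) :
    circleMean 2 r (deriv f) ≤ ENNReal.ofReal (r⁻¹ * (ρ - r)⁻¹) * maxModulus ρ f ^ (2 : ℝ) := by
  have hg := differentiableOn_deriv hf.1
  have hδ : 0 < ρ - r := by linarith
  have hρ0 : 0 < ρ := by linarith
  have hpol := lintegral_ball_polar (R := ρ) (H := fun z => ‖deriv f z‖ₑ ^ (2 : ℝ))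
    (ENNReal.continuous_rpow_const.comp_continuousOn
      (hg.continuousOn.mono (Metric.ball_subset_ball hρ1.le)).enorm)
    (ν := fun _ => 1) aemeasurable_const
  simp only [mul_one, lintegral_circle_eq] at hpol
  have hmean : ENNReal.ofReal (r * (ρ - r) * (2 * Real.pi)) * circleMean 2 r (deriv f) ≤
      ENNReal.ofReal Real.pi * maxModulus ρ f ^ (2 : ℝ) := by
    refine le_trans ?_ (lintegral_enorm_deriv_sq_le hf hρ0.le hρ1)
    rw [hpol]
    calc ENNReal.ofReal (r * (ρ - r) * (2 * Real.pi)) * circleMean 2 r (deriv f)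
        = ∫⁻ _ in Ioo r ρ, ENNReal.ofReal r *
            (ENNReal.ofReal (2 * Real.pi) * circleMean 2 r (deriv f)) := by
          rw [setLIntegral_const, Real.volume_Ioo, ENNReal.ofReal_mul (by positivity),
            ENNReal.ofReal_mul hr.le]
          ring
      _ ≤ ∫⁻ t in Ioo r ρ, ENNReal.ofReal t *
            (ENNReal.ofReal (2 * Real.pi) * circleMean 2 t (deriv f)) := by
          refine setLIntegral_mono' measurableSet_Ioo fun t ht => ?_
          gcongr
          · exact ht.1.le
          · exact circleMean_monotoneOn hg one_lt_two ⟨hr.le, hrρ.trans hρ1⟩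
              ⟨hr.le.trans ht.1.le, ht.2.trans hρ1⟩ ht.1.le
      _ ≤ _ := lintegral_mono_set (Ioo_subset_Ioo_left hr.le)
  have hπ := Real.pi_pos
  calc circleMean 2 r (deriv f)
      = ENNReal.ofReal (r * (ρ - r) * (2 * Real.pi))⁻¹ *
          (ENNReal.ofReal (r * (ρ - r) * (2 * Real.pi)) * circleMean 2 r (deriv f)) := by
        rw [← mul_assoc, ← ENNReal.ofReal_mul (by positivity), inv_mul_cancel₀ (by positivity),
          ENNReal.ofReal_one, one_mul]
    _ ≤ ENNReal.ofReal (r * (ρ - r) * (2 * Real.pi))⁻¹ *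
          (ENNReal.ofReal Real.pi * maxModulus ρ f ^ (2 : ℝ)) := by gcongr
    _ ≤ _ := by
        rw [← mul_assoc, ← ENNReal.ofReal_mul (by positivity)]
        refine mul_le_mul' (ENNReal.ofReal_le_ofReal ?_) le_rfl
        have : (r * (ρ - r) * (2 * Real.pi))⁻¹ * Real.pi = r⁻¹ * (ρ - r)⁻¹ / 2 := by
          field_simp
        rw [this]
        exact half_le_self (by positivity)

/-- Split `|f'| ^ q` as `|f'| ^ (q - 2) * |f'| ^ 2`: Cauchy bounds the first factor and area the
second, and the powers of `ρ - r` add up to `-(q - 2) - 1 = 1 - q`. -/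
lemma circleMean_deriv_le {f : ℂ → ℂ} (hf : f ∈ univalent) {q r ρ : ℝ} (hq : 2 ≤ q) (hr : 0 < r)
    (hrρ : r < ρ) (hρ1 : ρ < 1) :
    circleMean q r (deriv f) ≤
      ENNReal.ofReal (r⁻¹ * (ρ - r) ^ (1 - q)) * maxModulus ρ f ^ q := by
  have hδ : 0 < ρ - r := by linarith
  have hg := differentiableOn_deriv hf.1
  have hq2 : 0 ≤ q - 2 := by linarith
  have hm : Measurable fun θ => ‖deriv f (circleMap 0 r θ)‖ₑ ^ (2 : ℝ) :=
    (continuous_comp_circleMap hg.continuousOn hr.le (hrρ.trans hρ1)).enorm.measurable.pow_const _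
  calc circleMean q r (deriv f)
      ≤ maxModulus r (deriv f) ^ (q - 2) * circleMean 2 r (deriv f) := by
        rw [circleMean, circleMean, mul_left_comm, ← lintegral_const_mul _ hm]
        refine mul_le_mul' le_rfl (lintegral_mono fun θ => ?_)
        calc ‖deriv f (circleMap 0 r θ)‖ₑ ^ q
            = ‖deriv f (circleMap 0 r θ)‖ₑ ^ (q - 2) * ‖deriv f (circleMap 0 r θ)‖ₑ ^ (2 : ℝ) := by
              rw [← ENNReal.rpow_add_of_nonneg _ _ hq2 (by norm_num), sub_add_cancel]
          _ ≤ _ := by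
              gcongr
              exact enorm_le_maxModulus hg hr.le (hrρ.trans hρ1) (by simp [abs_of_pos hr])
    _ ≤ (ENNReal.ofReal (ρ - r)⁻¹ * maxModulus ρ f) ^ (q - 2) *
          (ENNReal.ofReal (r⁻¹ * (ρ - r)⁻¹) * maxModulus ρ f ^ (2 : ℝ)) := by
        gcongr
        · exact maxModulus_deriv_le hf.1 hr.le hrρ hρ1
        · exact circleMean_two_deriv_le hf hr hrρ hρ1
    _ = ENNReal.ofReal (((ρ - r)⁻¹) ^ (q - 2) * (r⁻¹ * (ρ - r)⁻¹)) *
          (maxModulus ρ f ^ (q - 2) * maxModulus ρ f ^ (2 : ℝ)) := by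
        rw [ENNReal.mul_rpow_of_nonneg _ _ hq2, ENNReal.ofReal_rpow_of_pos (by positivity),
          ENNReal.ofReal_mul (p := ((ρ - r)⁻¹) ^ (q - 2)) (by positivity)]
        ring
    _ = _ := by
        rw [← ENNReal.rpow_add_of_nonneg _ _ hq2 (by norm_num), sub_add_cancel]
        congr 2
        rw [Real.inv_rpow hδ.le, ← Real.rpow_neg hδ.le,
          show (ρ - r) ^ (1 - q) = (ρ - r) ^ (-(q - 2)) * (ρ - r)⁻¹ from ?_]
        · ring
        · rw [← Real.rpow_neg_one, ← Real.rpow_add hδ]; congr 1; ring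

/-! ### Comparison of the discrete sums -/

lemma IsNodeWeight.comparableOn {ω : ℂ → ℝ} {κ α : ℝ} {ν : ℝ → ℝ≥0∞}
    (h : IsNodeWeight ω κ α ν) {U : Set (ℂ → ℂ)} {G : (ℂ → ℂ) → ℝ → ℝ≥0∞}
    (hG : ∀ f ∈ U, MonotoneOn (G f) (Ico 0 1)) :
    ComparableOn U (fun f => ∫⁻ r in Ioo 0 1, G f r * ν r) (fun f => nodeSum ω κ α (G f)) := by
  obtain ⟨C, hC, h⟩ := h
  exact ⟨⟨C, hC, fun f hf => (h _ (hG f hf)).1⟩, ⟨C, hC, fun f hf => (h _ (hG f hf)).2⟩⟩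

lemma exists_nodeSum_maxModulus_le {ω : ℂ → ℝ} {κ c C p q : ℝ}
    (hr : IsRatio ω κ c C) (hp : 2 ≤ p) (hq : 2 ≤ q) :
    ∃ A : ℝ≥0, 0 < A ∧ ∀ f ∈ univalent,
      nodeSum ω κ 0 (fun r => maxModulus r f ^ p) ≤
        A * (nodeSum ω κ (p * (1 - 1 / q)) (fun r => circleMean q r (deriv f) ^ (p / q)) +
          ‖f 0‖ₑ ^ p) := by
  have h0 := hr.pos
  have h1 := hr.lt_one
  have hn := node_nonneg h0 h1
  have hl := node_lt_one h0
  have hd : 0 < 1 - κ := by linarith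
  have hp0 : 0 < p := by linarith
  have hq0 : 0 < q := by linarith
  have hpq : 0 < p / q := by positivity
  set α := p * (1 - 1 / q) with hα
  obtain ⟨B, hB⟩ := exists_hardy (p := p) (by linarith) hr.one_lt
  set b : ℝ := (1 - κ) ^ p * (2 / (κ * (1 - κ))) ^ (p / q) with hb
  have hb0 : 0 ≤ b := by positivity
  set e : ℝ≥0∞ := ENNReal.ofReal (C / κ ^ α) with he
  refine ⟨B * ((cell ω κ 0 0).toNNReal + b.toNNReal * e.toNNReal ^ 2) + 1, by positivity,
    fun f hf => ?_⟩
  have hg := differentiableOn_deriv hf.1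
  set S := nodeSum ω κ α (fun r => circleMean q r (deriv f) ^ (p / q)) with hS
  have hterm : ∀ n, (ENNReal.ofReal (node κ (n + 1) - node κ n) *
      maxModulus (node κ (n + 1)) (deriv f)) ^ p * cell ω κ 0 n ≤ ENNReal.ofReal b * e ^ 2 *
        (circleMean q (node κ (n + 2)) (deriv f) ^ (p / q) * cell ω κ α (n + 2)) := fun n => by
    have hy : 0 < κ ^ n := by positivity
    -- The gap contributes `κ ^ (n p)` and the Poisson bound `κ ^ (-n p / q)`; together they give
    -- exactly the exponent `α` of `I`.
    have hreal : (κ ^ n * (1 - κ)) ^ p * (2 / (κ ^ (n + 1) * (1 - κ))) ^ (p / q) =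
        b * (κ ^ n) ^ α := by
      have e1 : 2 / (κ ^ (n + 1) * (1 - κ)) = 2 / (κ * (1 - κ)) * (κ ^ n)⁻¹ := by
        rw [pow_succ]; field_simp
      have e2 : (κ ^ n) ^ α = (κ ^ n) ^ p * (κ ^ n) ^ (-(p / q)) := by
        rw [← Real.rpow_add hy, hα]; congr 1; field_simp; ring
      rw [e1, e2, Real.mul_rpow hy.le hd.le, Real.mul_rpow (by positivity) (by positivity),
        Real.inv_rpow hy.le, Real.rpow_neg hy.le, hb]
      ring
    have hmax : maxModulus (node κ (n + 1)) (deriv f) ^ p ≤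
        ENNReal.ofReal ((2 / (κ ^ (n + 1) * (1 - κ))) ^ (p / q)) *
          circleMean q (node κ (n + 2)) (deriv f) ^ (p / q) := by
      have := maxModulus_rpow_le hg (q := q) (by linarith) (hn (n + 1))
        (node_lt_succ h0 h1 (n + 1)) (hl (n + 2))
      rw [node_succ_sub] at this
      rw [← ENNReal.ofReal_rpow_of_pos (by positivity), ← ENNReal.mul_rpow_of_nonneg _ _ hpq.le]
      calc _ = (maxModulus (node κ (n + 1)) (deriv f) ^ q) ^ (p / q) := by
            rw [← ENNReal.rpow_mul]; congr 1; field_simp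
        _ ≤ _ := by gcongr
    calc (ENNReal.ofReal (node κ (n + 1) - node κ n) *
          maxModulus (node κ (n + 1)) (deriv f)) ^ p * cell ω κ 0 n
        ≤ ENNReal.ofReal ((κ ^ n * (1 - κ)) ^ p) *
          (ENNReal.ofReal ((2 / (κ ^ (n + 1) * (1 - κ))) ^ (p / q)) *
          circleMean q (node κ (n + 2)) (deriv f) ^ (p / q)) * cell ω κ 0 n := by
          rw [node_succ_sub, ENNReal.mul_rpow_of_nonneg _ _ hp0.le,
            ENNReal.ofReal_rpow_of_pos (by positivity)]
          gcongr
      _ = ENNReal.ofReal b * (circleMean q (node κ (n + 2)) (deriv f) ^ (p / q) *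
            cell ω κ α n) := by
          have : ENNReal.ofReal ((κ ^ n * (1 - κ)) ^ p) *
              ENNReal.ofReal ((2 / (κ ^ (n + 1) * (1 - κ))) ^ (p / q)) * cell ω κ 0 n =
              ENNReal.ofReal b * cell ω κ α n := by
            rw [← ENNReal.ofReal_mul (by positivity), hreal, cell, cell,
              ENNReal.ofReal_mul hb0, Real.rpow_zero, mul_one, mul_assoc,
              ← ENNReal.ofReal_mul (p := (κ ^ n) ^ α) (by positivity), mul_comm ((κ ^ n) ^ α)]
          rw [mul_left_comm (ENNReal.ofReal b), ← this]
          ring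
      -- The derivative was taken at the right end of the cell and its mean one node further, so the
      -- discrete weight is moved by two indices, at the cost of `e ^ 2`.
      _ ≤ ENNReal.ofReal b * (circleMean q (node κ (n + 2)) (deriv f) ^ (p / q) *
            (e * (e * cell ω κ α (n + 2)))) := by
          gcongr
          exact (cell_le_succ hr n).trans (mul_le_mul' le_rfl (cell_le_succ hr (n + 1)))
      _ = _ := by ring
  -- The initial term of the Hardy inequality sits at the node `0`, and this produces `|f(0)| ^ p`.
  have hhardy := hB (cell ω κ 0) (fun n => maxModulus (node κ n) f)
    (fun n => ENNReal.ofReal (node κ (n + 1) - node κ n) *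
      maxModulus (node κ (n + 1)) (deriv f)) (fun n => ?_)
    (fun n => maxModulus_le_add hf.1 (hn n) (node_lt_succ h0 h1 n).le (hl _))
  · have hcell0 : cell ω κ 0 0 ≠ ∞ := ENNReal.ofReal_ne_top
    have he0 : e ≠ ∞ := ENNReal.ofReal_ne_top
    calc nodeSum ω κ 0 (fun r => maxModulus r f ^ p)
        ≤ ∑' n, maxModulus (node κ n) f ^ p * cell ω κ 0 n :=
          ENNReal.tsum_comp_le_tsum_of_injective (add_left_injective 1)
            (fun n => maxModulus (node κ n) f ^ p * cell ω κ 0 n)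
      _ ≤ B * (‖f 0‖ₑ ^ p * cell ω κ 0 0 + ENNReal.ofReal b * e ^ 2 * S) := by
          refine hhardy.trans ?_
          simp only [node_zero, maxModulus_zero]
          refine mul_le_mul' le_rfl (add_le_add le_rfl ?_)
          refine (ENNReal.tsum_le_tsum hterm).trans ?_
          rw [ENNReal.tsum_mul_left]
          exact mul_le_mul' le_rfl (ENNReal.tsum_comp_le_tsum_of_injective (add_left_injective 1)
            (fun n => circleMean q (node κ (n + 1)) (deriv f) ^ (p / q) * cell ω κ α (n + 1)))
      _ ≤ B * ((cell ω κ 0 0 + ENNReal.ofReal b * e ^ 2) * (S + ‖f 0‖ₑ ^ p)) := by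
          refine mul_le_mul' le_rfl ?_
          calc ‖f 0‖ₑ ^ p * cell ω κ 0 0 + ENNReal.ofReal b * e ^ 2 * S
              ≤ ‖f 0‖ₑ ^ p * cell ω κ 0 0 + ENNReal.ofReal b * e ^ 2 * S +
                (cell ω κ 0 0 * S + ENNReal.ofReal b * e ^ 2 * ‖f 0‖ₑ ^ p) := le_self_add
            _ = _ := by ring
      _ ≤ _ := by
          rw [← mul_assoc]
          refine mul_le_mul' ?_ le_rfl
          push_cast
          rw [ENNReal.coe_toNNReal hcell0, ENNReal.coe_toNNReal he0]
          exact le_self_add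
  · simp only [cell, Real.rpow_zero, mul_one]
    rw [← ENNReal.ofReal_mul (by linarith [hr.one_lt])]
    exact ENNReal.ofReal_le_ofReal (hr.lower n)

lemma exists_nodeSum_circleMean_le {ω : ℂ → ℝ} {κ c C p q : ℝ} (hω : IsRadialWeight ω)
    (hr : IsRatio ω κ c C) (hp : 2 ≤ p) (hq : 2 ≤ q) :
    ∃ A : ℝ≥0, 0 < A ∧ ∀ f ∈ univalent,
      nodeSum ω κ (p * (1 - 1 / q)) (fun r => circleMean q r (deriv f) ^ (p / q)) + ‖f 0‖ₑ ^ p ≤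
        A * nodeSum ω κ 0 (fun r => maxModulus r f ^ p) := by
  have h0 := hr.pos
  have h1 := hr.lt_one
  have hn := node_nonneg h0 h1
  have hl := node_lt_one h0
  have hd : 0 < 1 - κ := by linarith
  have hp0 : 0 < p := by linarith
  have hq0 : 0 < q := by linarith
  have hpq : 0 < p / q := by positivity
  set α := p * (1 - 1 / q) with hα
  set b : ℝ := ((1 - κ)⁻¹) ^ (p / q) * (1 - κ) ^ (-α) with hb
  have hb0 : 0 ≤ b := by positivity
  set e : ℝ≥0∞ := ENNReal.ofReal (C / κ ^ (0 : ℝ)) with he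
  have he0 : e ≠ ∞ := ENNReal.ofReal_ne_top
  set t : ℝ := tail ω (node κ 1 : ℂ) with ht
  have ht0 : 0 < t := hω.tail_pos_coe (hn 1) (hl 1)
  refine ⟨b.toNNReal * e.toNNReal + t⁻¹.toNNReal + 1, by positivity, fun f hf => ?_⟩
  set S := nodeSum ω κ 0 (fun r => maxModulus r f ^ p) with hS
  have hterm : ∀ n, circleMean q (node κ (n + 1)) (deriv f) ^ (p / q) * cell ω κ α (n + 1) ≤
      ENNReal.ofReal b * e * (maxModulus (node κ (n + 2)) f ^ p * cell ω κ 0 (n + 2)) := fun n => by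
    have hy : 0 < κ ^ (n + 1) := by positivity
    -- The sums start at index `1`, which keeps `r⁻¹` in the mean estimate below `(1 - κ)⁻¹`.
    have hnode : 1 - κ ≤ node κ (n + 1) := by
      have := node_mono h0 h1 (Nat.le_add_left 1 n)
      simpa [node] using this
    have hnode0 : 0 < node κ (n + 1) := by linarith
    have hreal : ((node κ (n + 1))⁻¹ * (κ ^ (n + 1) * (1 - κ)) ^ (1 - q)) ^ (p / q) *
        (κ ^ (n + 1)) ^ α ≤ b := by
      have hαe : (1 - q) * (p / q) = -α := by rw [hα]; field_simp; ring
      calc ((node κ (n + 1))⁻¹ * (κ ^ (n + 1) * (1 - κ)) ^ (1 - q)) ^ (p / q) * (κ ^ (n + 1)) ^ α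
          ≤ ((1 - κ)⁻¹ * (κ ^ (n + 1) * (1 - κ)) ^ (1 - q)) ^ (p / q) * (κ ^ (n + 1)) ^ α := by
            gcongr
        _ = ((1 - κ)⁻¹) ^ (p / q) * (1 - κ) ^ (-α) *
              ((κ ^ (n + 1)) ^ (-α) * (κ ^ (n + 1)) ^ α) := by
            rw [Real.mul_rpow (by positivity) (by positivity), ← Real.rpow_mul (by positivity), hαe,
              Real.mul_rpow hy.le hd.le]
            ring
        _ = b := by rw [← Real.rpow_add hy, neg_add_cancel, Real.rpow_zero, mul_one]
    have hmean := circleMean_deriv_le hf hq hnode0 (node_lt_succ h0 h1 (n + 1)) (hl (n + 2))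
    rw [node_succ_sub] at hmean
    calc circleMean q (node κ (n + 1)) (deriv f) ^ (p / q) * cell ω κ α (n + 1)
        ≤ (ENNReal.ofReal ((node κ (n + 1))⁻¹ * (κ ^ (n + 1) * (1 - κ)) ^ (1 - q)) *
            maxModulus (node κ (n + 2)) f ^ q) ^ (p / q) * cell ω κ α (n + 1) := by gcongr
      _ = ENNReal.ofReal (((node κ (n + 1))⁻¹ * (κ ^ (n + 1) * (1 - κ)) ^ (1 - q)) ^ (p / q) *
            (κ ^ (n + 1)) ^ α) * (maxModulus (node κ (n + 2)) f ^ p * cell ω κ 0 (n + 1)) := by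
          have hqp : q * (p / q) = p := by field_simp
          rw [ENNReal.mul_rpow_of_nonneg _ _ hpq.le, ← ENNReal.rpow_mul, hqp,
            ENNReal.ofReal_rpow_of_pos (by positivity), cell, cell, Real.rpow_zero, mul_one,
            ENNReal.ofReal_mul' (by positivity), ENNReal.ofReal_mul' (by positivity)]
          ring
      _ ≤ ENNReal.ofReal b *
            (maxModulus (node κ (n + 2)) f ^ p * (e * cell ω κ 0 (n + 2))) := by
          refine mul_le_mul' (ENNReal.ofReal_le_ofReal hreal) (mul_le_mul' le_rfl ?_)
          exact cell_le_succ hr (n + 1)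
      _ = _ := by ring
  have hsum : nodeSum ω κ α (fun r => circleMean q r (deriv f) ^ (p / q)) ≤
      ENNReal.ofReal b * e * S := by
    refine (ENNReal.tsum_le_tsum hterm).trans ?_
    rw [ENNReal.tsum_mul_left]
    exact mul_le_mul' le_rfl (ENNReal.tsum_comp_le_tsum_of_injective (add_left_injective 1)
      (fun n => maxModulus (node κ (n + 1)) f ^ p * cell ω κ 0 (n + 1)))
  -- The first term of the sum alone dominates `|f(0)| ^ p`, since its weight is `t`.
  have hzero : ‖f 0‖ₑ ^ p ≤ ENNReal.ofReal t⁻¹ * S := by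
    calc ‖f 0‖ₑ ^ p ≤ maxModulus (node κ 1) f ^ p := by
          gcongr
          exact enorm_le_maxModulus hf.1 (hn 1) (hl 1) (by simpa using hn 1)
      _ = ENNReal.ofReal t⁻¹ * (maxModulus (node κ (0 + 1)) f ^ p * cell ω κ 0 (0 + 1)) := by
          rw [cell, Real.rpow_zero, mul_one, mul_left_comm, ← ENNReal.ofReal_mul (by positivity),
            zero_add, ← ht, inv_mul_cancel₀ ht0.ne', ENNReal.ofReal_one, mul_one]
      _ ≤ _ := by
          gcongr
          exact ENNReal.le_tsum (f := fun n => maxModulus (node κ (n + 1)) f ^ p *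
            cell ω κ 0 (n + 1)) 0
  calc _ ≤ ENNReal.ofReal b * e * S + ENNReal.ofReal t⁻¹ * S := add_le_add hsum hzero
    _ = (ENNReal.ofReal b * e + ENNReal.ofReal t⁻¹) * S := by ring
    _ ≤ _ := by
        refine mul_le_mul' ?_ le_rfl
        push_cast
        rw [ENNReal.coe_toNNReal he0]
        exact le_self_add

/-! ### The four quantities -/

lemma comparableOn_J {ω : ℂ → ℝ} {κ c C p : ℝ} (hω : IsRadialWeight ω) (hr : IsRatio ω κ c C)
    (hp : 2 ≤ p) :
    ComparableOn univalent (fun f => J p ω f)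
      (fun f => nodeSum ω κ 0 (fun r => maxModulus r f ^ p)) := by
  have h := (isNodeWeight_shift hω hr le_rfl).comparableOn (U := univalent)
    (G := fun f r => maxModulus r f ^ p) fun f hf a ha b hb hab =>
      ENNReal.rpow_le_rpow (maxModulus_monotoneOn hf.1 ha hb hab) (by linarith)
  simp only [Real.rpow_zero, mul_one] at h
  exact h

lemma comparableOn_I {ω : ℂ → ℝ} {κ c C p q : ℝ} (hω : IsRadialWeight ω) (hr : IsRatio ω κ c C)
    (hp : 2 ≤ p) (hq : 2 ≤ q) :
    ComparableOn univalent (fun f => I p q ω f)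
      (fun f => nodeSum ω κ (p * (1 - 1 / q)) (fun r => circleMean q r (deriv f) ^ (p / q))) := by
  have hq1 : 1 / q ≤ 1 := by rw [div_le_one (by linarith)]; linarith
  have h := (isNodeWeight_shift hω hr (α := p * (1 - 1 / q))
    (mul_nonneg (by linarith) (by linarith))).comparableOn (U := univalent)
    (G := fun f r => circleMean q r (deriv f) ^ (p / q)) fun f hf a ha b hb hab =>
      ENNReal.rpow_le_rpow (circleMean_monotoneOn (differentiableOn_deriv hf.1) (by linarith)
        ha hb hab) (div_nonneg (by linarith) (by linarith))
  have hI : ∀ f, I p q ω f = ∫⁻ r in Ioo (0 : ℝ) 1, circleMean q r (deriv f) ^ (p / q) *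
      ENNReal.ofReal (ω (r : ℂ) * (1 - r) ^ (p * (1 - 1 / q))) := fun f => by
    refine lintegral_congr fun r => ?_
    rw [mul_comm (ω (r : ℂ)), div_eq_inv_mul p q, ENNReal.rpow_mul, ← one_div]
    rfl
  simpa only [hI] using h

/-- Polar coordinates turn the area integral into a radial integral of `p`-th power means of `f'`.
-/
lemma comparableOn_bergmanPow {ω μ : ℂ → ℝ} {κ c C p : ℝ} (hr : IsRatio ω κ c C)
    (hp : 2 ≤ p) (hμ : ∀ z ∈ disc, μ z = μ (‖z‖ : ℂ))
    (hμm : AEMeasurable (fun r : ℝ => μ (r : ℂ)) (volume.restrict (Ioo 0 1)))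
    (hμn : IsNodeWeight ω κ (p - 1) (fun r => ENNReal.ofReal (μ (r : ℂ)))) :
    ComparableOn univalent (fun f => bergmanPow p μ (deriv f))
      (fun f => nodeSum ω κ (p * (1 - 1 / p)) (fun r => circleMean p r (deriv f) ^ (p / p))) := by
  have h0 := hr.pos
  have h1 := hr.lt_one
  have hp0 : p ≠ 0 := by linarith
  have hd : 0 < 1 - κ := by linarith
  -- The Jacobian `r` vanishes at `0`, so it goes into the increasing function rather than the
  -- weight; at the nodes that are summed it lies between `1 - κ` and `1`.
  set G : (ℂ → ℂ) → ℝ → ℝ≥0∞ := fun f r =>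
    ENNReal.ofReal r * (ENNReal.ofReal (2 * Real.pi) * circleMean p r (deriv f)) with hG
  have h := hμn.comparableOn (U := univalent) (G := G) fun f hf a ha b hb hab =>
    mul_le_mul' (ENNReal.ofReal_le_ofReal hab) (mul_le_mul' le_rfl
      (circleMean_monotoneOn (differentiableOn_deriv hf.1) (by linarith) ha hb hab))
  have hB : ∀ f ∈ univalent, bergmanPow p μ (deriv f) =
      ∫⁻ r in Ioo 0 1, G f r * ENNReal.ofReal (μ (r : ℂ)) := fun f hf => by
    have := lintegral_ball_polar (R := 1) (H := fun z => ‖deriv f z‖ₑ ^ p)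
      (ENNReal.continuous_rpow_const.comp_continuousOn
        (differentiableOn_deriv hf.1).continuousOn.enorm) hμm.ennreal_ofReal
    simp only [lintegral_circle_eq] at this
    rw [hG, ← this, bergmanPow]
    exact setLIntegral_congr_fun Metric.isOpen_ball.measurableSet fun z hz => by
      rw [hμ z hz]
  have hα : p * (1 - 1 / p) = p - 1 := by field_simp
  simp only [hα, div_self hp0, ENNReal.rpow_one]
  have h' : ComparableOn univalent (fun f => nodeSum ω κ (p - 1) (G f))
      (fun f => nodeSum ω κ (p - 1) (fun r => circleMean p r (deriv f))) := by
    have hπ := Real.pi_pos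
    refine ⟨⟨(2 * Real.pi).toNNReal, by simpa, fun f _ => ?_⟩,
      ⟨((1 - κ) * (2 * Real.pi))⁻¹.toNNReal, ?_, fun f _ => ?_⟩⟩
    · simp only [nodeSum]
      rw [← ENNReal.tsum_mul_left]
      refine ENNReal.tsum_le_tsum fun n => ?_
      rw [← mul_assoc]
      refine mul_le_mul' ?_ le_rfl
      refine mul_le_of_le_one_left' ?_
      rw [ENNReal.ofReal_le_one]
      exact (node_lt_one h0 _).le
    · exact Real.toNNReal_pos.2 (by positivity)
    · simp only [nodeSum]
      rw [← ENNReal.tsum_mul_left]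
      refine ENNReal.tsum_le_tsum fun n => ?_
      have hnode : 1 - κ ≤ node κ (n + 1) := by
        have := node_mono h0 h1 (Nat.le_add_left 1 n)
        simpa [node] using this
      rw [← mul_assoc]
      refine mul_le_mul' ?_ le_rfl
      calc circleMean p (node κ (n + 1)) (deriv f)
          = ENNReal.ofReal ((1 - κ) * (2 * Real.pi))⁻¹ * (ENNReal.ofReal (1 - κ) *
              (ENNReal.ofReal (2 * Real.pi) * circleMean p (node κ (n + 1)) (deriv f))) := by
            rw [← mul_assoc (ENNReal.ofReal (1 - κ)), ← ENNReal.ofReal_mul hd.le, ← mul_assoc,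
              ← ENNReal.ofReal_mul (by positivity), inv_mul_cancel₀ (by positivity),
              ENNReal.ofReal_one, one_mul]
        _ ≤ _ := mul_le_mul' le_rfl (mul_le_mul' (ENNReal.ofReal_le_ofReal hnode) le_rfl)
  refine ComparableOn.trans ⟨?_, ?_⟩ h'
  · obtain ⟨K, hK, h⟩ := h.1
    exact ⟨K, hK, fun f hf => by simpa only [hB f hf] using h f hf⟩
  · obtain ⟨K, hK, h⟩ := h.2
    exact ⟨K, hK, fun f hf => by simpa only [hB f hf] using h f hf⟩

end WeightedDirichlet

open WeightedDirichlet in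
theorem theorem6 (p q : ℝ) (hp : 2 ≤ p) (hq : 2 ≤ q) (ω : ℂ → ℝ)
    (hω : WeightedDirichlet.IsDoublingWeight ω) :
    WeightedDirichlet.ComparableOn WeightedDirichlet.univalent
      (fun f => WeightedDirichlet.dirichletPow p (WeightedDirichlet.shift ω (p - 1)) f
        + ‖f 0‖ₑ ^ p)
      (fun f => WeightedDirichlet.dirichletPow p
        (WeightedDirichlet.shift (WeightedDirichlet.tail ω) (p - 2)) f + ‖f 0‖ₑ ^ p) ∧
    WeightedDirichlet.ComparableOn WeightedDirichlet.univalent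
      (fun f => WeightedDirichlet.dirichletPow p
        (WeightedDirichlet.shift (WeightedDirichlet.tail ω) (p - 2)) f + ‖f 0‖ₑ ^ p)
      (fun f => WeightedDirichlet.J p ω f) ∧
    WeightedDirichlet.ComparableOn WeightedDirichlet.univalent
      (fun f => WeightedDirichlet.J p ω f)
      (fun f => WeightedDirichlet.I p q ω f + ‖f 0‖ₑ ^ p) := by
  obtain ⟨κ, c, C, hr⟩ := hω.exists_ratio
  have hw := hω.weight
  -- `J` is the hub: `s = p` links it to both Dirichlet quantities and `s = q` to `I`.
  have hdiscrete : ∀ s, 2 ≤ s → ComparableOn univalent (fun f => J p ω f)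
      (fun f => nodeSum ω κ (p * (1 - 1 / s)) (fun r => circleMean s r (deriv f) ^ (p / s)) +
        ‖f 0‖ₑ ^ p) := fun s hs =>
    (comparableOn_J hw hr hp).trans
      ⟨exists_nodeSum_maxModulus_le hr hp hs, exists_nodeSum_circleMean_le hw hr hp hs⟩
  have hdir : ∀ μ : ℂ → ℝ, ComparableOn univalent (fun f => bergmanPow p μ (deriv f))
      (fun f => nodeSum ω κ (p * (1 - 1 / p)) (fun r => circleMean p r (deriv f) ^ (p / p))) →
      ComparableOn univalent (fun f => dirichletPow p μ f + ‖f 0‖ₑ ^ p) (fun f => J p ω f) :=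
    fun μ h => (comparableOn_add_add univalent (fun f => bergmanPow p μ (deriv f)) _).trans
      ((h.add_right _).trans (hdiscrete p hp).symm)
  have hωm := hw.integrable.aestronglyMeasurable.aemeasurable
  have hcongr : ∀ {ν ν' : ℝ → ℝ≥0∞} {α : ℝ}, IsNodeWeight ω κ α ν → EqOn ν' ν (Ioo 0 1) →
      IsNodeWeight ω κ α ν' := fun {ν ν' α} h he => by
    obtain ⟨A, hA, h⟩ := h
    refine ⟨A, hA, fun G hG => ?_⟩
    have : ∫⁻ r in Ioo 0 1, G r * ν' r = ∫⁻ r in Ioo 0 1, G r * ν r :=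
      setLIntegral_congr_fun measurableSet_Ioo fun r hr => by rw [he hr]
    rw [this]
    exact h G hG
  have hshift : ∀ (ν : ℂ → ℝ) (x r : ℝ), r ∈ Ioo (0 : ℝ) 1 →
      shift ν x (r : ℂ) = ν (r : ℂ) * (1 - r) ^ x := fun ν x r hr => by
    rw [shift, norm_coe_of_nonneg hr.1.le]
  have hfirst := hdir (shift ω (p - 1)) <| comparableOn_bergmanPow hr hp
    (fun z hz => by rw [shift, shift, hw.radial z hz, norm_coe_of_nonneg (norm_nonneg z)])
    ((hωm.mul (by fun_prop : AEMeasurable (fun r : ℝ => (1 - |r|) ^ (p - 1)) _)).congr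
      (.of_forall fun r => by simp [shift]))
    (hcongr (isNodeWeight_shift hw hr (by linarith)) fun r hr => by simp only [hshift _ _ r hr])
  have htail : AEMeasurable (fun r : ℝ => tail ω (r : ℂ)) (volume.restrict (Ioo 0 1)) :=
    aemeasurable_restrict_of_antitoneOn measurableSet_Ioo
      fun a ha b hb hab => hw.tail_antitone ha.1.le hab hb.2
  have hsecond := hdir (shift (tail ω) (p - 2)) <| comparableOn_bergmanPow hr hp
    (fun z hz => by simp [shift, tail])
    ((htail.mul (by fun_prop : AEMeasurable (fun r : ℝ => (1 - |r|) ^ (p - 2)) _)).congr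
      (.of_forall fun r => by simp [shift]))
    (hcongr (by simpa [show p - 2 + 1 = p - 1 by ring] using
      isNodeWeight_tail hw hr (α := p - 2) (by linarith))
      fun r hr => by simp only [hshift _ _ r hr])
  exact ⟨hfirst.trans hsecond.symm, hsecond,
    (hdiscrete q hq).trans ((comparableOn_I hw hr hp hq).symm.add_right _)⟩
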